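/- Let $(X,d)$ be a proper metric space (hence complete and separable), let $A\subseteq X$ be closed and non-empty, and let $p\in(1,\infty)$. Put $\Omega=X\setminus A$ and $E_\Omega=(X\times X)\setminus(A\times A)$, and let $\mathcal M_p(X,A)$ be the set of Radon measures $\mu\ge 0$ on $\Omega$ with $\int_\Omega d(x,A)^p\,d\mu(x)<\infty$. For $\mu,\nu\in\mathcal M_p(X,A)$ let $\mathrm{Adm}(\mu,\nu)$ be the set of non-negative Borel measures $\gamma$ on $E_\Omega$ with $(\pi^1_\#\gamma)|_\Omega=\mu$ and $(\pi^2_\#\gamma)|_\Omega=\nu$, where $\pi^1,\pi^2$ are the coordinate projections, let $$\mathrm{Wb}_p(\mu,\nu)=\inf_{\gamma\in\mathrm{Adm}(\mu,\nu)}\Big(\int_{E_\Omega}d(x,y)^p\,d\gamma(x,y)\Big)^{1/p},$$ and let $\mathrm{Opt}(\mu,\nu)$ be the set of those $\gamma\in\mathrm{Adm}(\mu,\nu)$ for which $\int_{E_\Omega}d(x,y)^p\,d\gamma=\mathrm{Wb}_p(\mu,\nu)^p$. Equip $\mathcal M_p(X,A)$ with the metric $\mathrm{Wb}_p$. A geodesic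 in a metric space $Y$ is a curve $\xi:[0,1]\to Y$ with $d_Y(\xi_s,\xi_t)=d_Y(\xi_0,\xi_1)\,|s-t|$ for all $s,t\in[0,1]$; $Y$ is geodesic if any two of its points are the endpoints $\xi_0,\xi_1$ of a geodesic $\xi$; and a geodesic space $Y$ is non-branching if for every $t\in(0,1)$ the map $\xi\mapsto(\xi_0,\xi_t)$ is injective on the set of geodesics of $Y$. Suppose that $X$ is geodesic and non-branching. Then $\mathcal M_p(X,A)$ is a non-branching geodesic space. Furthermore, let $(\mu_t)_{t\in[0,1]}$ be a geodesic in $\mathcal M_p(X,A)$ and let $t\in(0,1)$. Then the restriction $\gamma_X^\Omega=\gamma|_{X\times\Omega}$ is the same for all $\gamma\in\mathrm{Opt}(\mu_0,\mu_t)$, and it is induced by a map: for each such $\gamma$ there is a Borel map $T:\Omega\to X$ with $\gamma_X^\Omega=(T,\mathrm{id})_\#\mu_t$. -/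

import Mathlib

open MeasureTheory
open scoped ENNReal unitInterval

namespace MetricPair

section Geodesics

variable {X : Type*} [Dist X]

/-- Constant speed geodesics parametrised by `[0,1]`. Continuity of the curve is not listed, since it
follows from the displayed identity. Only the distance function enters, so that the same definition
serves for `X` and for the space of measures `Mp A p` below. -/
def IsGeodesic (ξ : I → X) : Prop :=
  ∀ s t : I, dist (ξ s) (ξ t) = dist (ξ 0) (ξ 1) * |(s : ℝ) - (t : ℝ)|

variable (X)

/-- The set of all geodesics of `X`. -/
def Geo : Type _ := {ξ : I → X // IsGeodesic ξ}

/-- Any two points are joined by a geodesic. -/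
def IsGeodesicSpace : Prop :=
  ∀ x y : X, ∃ ξ : Geo X, ξ.1 0 = x ∧ ξ.1 1 = y

/-- A non-branching geodesic space: for each `0 < t < 1`, a geodesic is determined by its positions
at the times `0` and `t`. -/
def IsNonBranching : Prop :=
  IsGeodesicSpace X ∧
    ∀ t : I, 0 < t → t < 1 → Function.Injective (fun ξ : Geo X => (ξ.1 0, ξ.1 t))

end Geodesics

/-- Radon measures: Borel measures that are finite on compact sets and inner regular. -/
structure IsRadon {Y : Type*} [TopologicalSpace Y] [MeasurableSpace Y] (μ : Measure Y) :
    Prop where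
  finite_on_compacts : ∀ K : Set Y, IsCompact K → μ K < ∞
  inner_regular : ∀ E : Set Y, MeasurableSet E →
    μ E = ⨆ (K : Set Y) (_ : K ⊆ E) (_ : IsCompact K), μ K

section Transport

variable {X : Type*} [MetricSpace X] [MeasurableSpace X]

/-- The open set `Ω = X \ A`, as a subspace of `X`. -/
abbrev Omega (A : Set X) : Type _ := {x : X // x ∉ A}

/-- The open set `E_Ω = (X × X) \ (A × A)`, as a subspace of `X × X`. -/
abbrev EOmega (A : Set X) : Type _ := {z : X × X // z ∉ A ×ˢ A}

/-- The space `M_p(X, A)` of Radon measures `μ` on `Ω` such that `∫ d(x, A) ^ p dμ(x) < ∞`. -/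
def Mp (A : Set X) (p : ℝ) : Type _ :=
  {μ : Measure (Omega A) // IsRadon μ ∧ ∫⁻ x, Metric.infEDist (x : X) A ^ p ∂μ < ∞}

/-- The admissible partial transport plans between `μ` and `ν`: measures on `E_Ω` whose two marginals
on `X`, restricted to `Ω`, are `μ` and `ν`. -/
def Adm {A : Set X} (μ ν : Measure (Omega A)) : Set (Measure (EOmega A)) :=
  {γ | (γ.map (fun z => z.1.1)).comap (Subtype.val : Omega A → X) = μ ∧
    (γ.map (fun z => z.1.2)).comap (Subtype.val : Omega A → X) = ν}

/-- The cost `∫ d(x, y) ^ p dγ(x, y)` of a plan. -/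
noncomputable def cost {A : Set X} (p : ℝ) (γ : Measure (EOmega A)) : ℝ≥0∞ :=
  ∫⁻ z, edist z.1.1 z.1.2 ^ p ∂γ

/-- The optimal partial transport distance `Wb_p`, with values in `[0, ∞]`. -/
noncomputable def Wb {A : Set X} (p : ℝ) (μ ν : Measure (Omega A)) : ℝ≥0∞ :=
  ⨅ γ ∈ Adm μ ν, cost p γ ^ (1 / p)

/-- The optimal partial transport plans between `μ` and `ν`. -/
def Opt {A : Set X} (p : ℝ) (μ ν : Measure (Omega A)) : Set (Measure (EOmega A)) :=
  {γ | γ ∈ Adm μ ν ∧ cost p γ = Wb p μ ν ^ p}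

/-- `M_p(X, A)` carries the distance `Wb_p`. -/
noncomputable instance (A : Set X) (p : ℝ) : Dist (Mp A p) where
  dist μ ν := (Wb p μ.1 ν.1).toReal

/-- The part of the plan `γ` that is carried by `X × Ω`. -/
noncomputable def targetPart {A : Set X} (γ : Measure (EOmega A)) : Measure (EOmega A) :=
  γ.restrict {z | z.1.2 ∉ A}

/-- For a map `T : Ω → X`, the map `(T, id) : Ω → X × Ω ⊆ E_Ω`. -/
def graphMap {A : Set X} (T : Omega A → X) (y : Omega A) : EOmega A :=
  ⟨(T y, y.1), fun h => y.2 h.2⟩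

end Transport

end MetricPair

/-!
Optimal partial transport reduces to three facts about a proper metric space `X`.

*Optimal plans exist* (`exists_mem_Opt`). Plans may have infinite mass near `A × A`, but if `h` is
the function `weight`, which is positive exactly off `A` and integrable for all measures in
`M_p(X, A)`, then multiplication by `h(x) + h(y)` turns the plans between two given measures into
measures of a fixed finite mass. Those of bounded cost are tight, the marginal constraints are
closed under weak convergence, and the cost is lower semicontinuous.

*`M_p(X, A)` is geodesic* (`isGeodesicSpace_Mp`). Geodesics of `X` can be chosen measurably in
their end points, since the geodesics form a proper metric space by the Arzelà–Ascoli theorem and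
a continuous surjection from such a space has a measurable section. The images of an optimal plan
under the chosen geodesics at the times `t ∈ [0, 1]`, restricted to `Ω`, form a geodesic of
measures.

*Optimal plans out of the middle of a geodesic are rigid* (`exists_map_of_aligned`). Let `μ₁` lie
between `μ₀` and `μ₂` on a geodesic. Two optimal plans, from `μ₁` to `μ₀` and from `μ₁` to `μ₂`,
are glued along `μ₁`, conditionally independently given the point of `μ₁`. In the chain of
inequalities that bounds the distance of `μ₀` and `μ₂` by the cost of the gluing, equality holds
throughout, so that by strict convexity of `t ↦ t ^ p` the glued measure is carried by triples
`(x, y, z)` for which `y` lies on a geodesic from `x` to `z`, at a fixed ratio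
(`ae_aligned_glue`). Hence no mass of the plan to `μ₂` comes out of `A`. Moreover, for almost
every `y`, independence pairs a single `x` with almost every possible `z`, and the non-branching
property of `X` leaves only one `z`: the conditional measure at `y` is a Dirac measure, and the
plan is induced by a map. As `z` depends only on `x` and `y`, the same comparison applies to the
plans towards two different continuations of the geodesic beyond `μ₁`, and shows that they
coincide.

Forward in time, rigidity shows that a geodesic of measures is determined by its positions at the
times `0` and `t`. Backward in time, it shows that an optimal plan from `μ₀` to `μ_t` is unique,
carried by `X × Ω`, and induced by a map defined on `Ω`.
-/

set_option linter.unusedSectionVars false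

namespace MetricPair

/-! ### Measurable selection -/

/-- A continuous surjection from a proper metric space onto a Hausdorff space has a measurable right
inverse. The images of closed balls are compact, hence measurable, so that a point of each fibre can
be approximated, in a measurable way, by points of a dense sequence. -/
theorem exists_measurable_rightInverse {Z Y : Type*} [MetricSpace Z] [ProperSpace Z]
    [MeasurableSpace Z] [BorelSpace Z] [TopologicalSpace Y] [T2Space Y] [MeasurableSpace Y]
    [OpensMeasurableSpace Y] {f : Z → Y} (hf : Continuous f) (hs : Function.Surjective f) :
    ∃ g : Y → Z, Measurable g ∧ ∀ y, f (g y) = y := by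
  classical
  rcases isEmpty_or_nonempty Y with hY | hY
  · exact ⟨fun y => isEmptyElim y, measurable_of_empty _, fun y => isEmptyElim y⟩
  have hZ : Nonempty Z := hs.nonempty
  let q : ℕ → Z := TopologicalSpace.denseSeq Z
  have hq : ∀ (z : Z) (r : ℝ), 0 < r → ∃ n, dist z (q n) < r := fun z r hr =>
    (TopologicalSpace.denseRange_denseSeq Z).exists_dist_lt z hr
  have hmeas : ∀ (z : Z) (r : ℝ), MeasurableSet (f '' Metric.closedBall z r) := fun z r =>
    ((isCompact_closedBall z r).image hf).measurableSet
  let P : ℝ → (Y → Z) → Prop := fun r s =>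
    Measurable s ∧ ∀ y, y ∈ f '' Metric.closedBall (s y) r
  have step : ∀ (r : ℝ) (s : Y → Z), 0 < r → P r s →
      ∃ s', P (r / 2) s' ∧ ∀ y, dist (s y) (s' y) ≤ 2 * r := by
    intro r s hr ⟨hsm, hsr⟩
    have hex : ∀ y, ∃ n, y ∈ f '' Metric.closedBall (q n) (r / 2) ∧ dist (s y) (q n) ≤ 2 * r := by
      intro y
      obtain ⟨z, hz, rfl⟩ := hsr y
      obtain ⟨n, hn⟩ := hq z (r / 2) (by positivity)
      refine ⟨n, ⟨z, hn.le, rfl⟩, ?_⟩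
      have h1 : dist z (s (f z)) ≤ r := hz
      have := dist_triangle (s (f z)) z (q n)
      rw [dist_comm (s (f z)) z] at this
      linarith
    refine ⟨fun y => q (Nat.find (hex y)), ⟨?_, fun y => (Nat.find_spec (hex y)).1⟩,
      fun y => (Nat.find_spec (hex y)).2⟩
    refine (measurable_from_nat (f := q)).comp (measurable_find hex fun k => ?_)
    exact (hmeas (q k) (r / 2)).inter
      (measurableSet_le (hsm.dist measurable_const) measurable_const)
  have start : ∃ s, P 1 s := by
    have hex : ∀ y, ∃ n, y ∈ f '' Metric.closedBall (q n) 1 := by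
      intro y
      obtain ⟨z, rfl⟩ := hs y
      obtain ⟨n, hn⟩ := hq z 1 one_pos
      exact ⟨n, z, hn.le, rfl⟩
    exact ⟨fun y => q (Nat.find (hex y)),
      (measurable_from_nat (f := q)).comp (measurable_find hex fun k => hmeas (q k) 1),
      fun y => Nat.find_spec (hex y)⟩
  obtain ⟨s₀, hs₀⟩ := start
  choose! F hF using step
  let u : ℕ → Y → Z := fun n => Nat.rec s₀ (fun k s => F ((1 / 2) ^ k) s) n
  have hu : ∀ n, P ((1 / 2) ^ n) (u n) := by
    intro n
    induction n with
    | zero => rw [pow_zero]; exact hs₀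
    | succ k ih =>
      have := (hF ((1 / 2) ^ k) (u k) (by positivity) ih).1
      rwa [show ((1 : ℝ) / 2) ^ (k + 1) = (1 / 2) ^ k / 2 by ring]
  have hd : ∀ y n, dist (u n y) (u (n + 1) y) ≤ 2 * (1 / 2 : ℝ) ^ n := fun y n =>
    (hF ((1 / 2) ^ n) (u n) (by positivity) (hu n)).2 y
  have hlim : ∀ y, ∃ z, Filter.Tendsto (fun n => u n y) Filter.atTop (nhds z) := fun y =>
    cauchySeq_tendsto_of_complete (cauchySeq_of_le_geometric (1 / 2) 2 (by norm_num) (hd y))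
  choose g hg using hlim
  refine ⟨g, measurable_of_tendsto_metrizable (fun n => (hu n).1) (tendsto_pi_nhds.2 hg),
    fun y => ?_⟩
  choose z hz hzy using fun n => (hu n).2 y
  have hz' : Filter.Tendsto z Filter.atTop (nhds (g y)) := by
    refine (hg y).congr_dist (squeeze_zero (fun _ => dist_nonneg) (fun n => ?_)
      (tendsto_pow_atTop_nhds_zero_of_lt_one (r := (1 / 2 : ℝ)) (by norm_num) (by norm_num)))
    rw [dist_comm]
    exact hz n
  have h1 : Filter.Tendsto (fun n => f (z n)) Filter.atTop (nhds (f (g y))) :=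
    (hf.tendsto _).comp hz'
  simp only [hzy] at h1
  exact tendsto_nhds_unique h1 tendsto_const_nhds

/-- Every closed non-empty subset of a proper metric space admits a measurable nearest point map. -/
theorem exists_measurable_nearest {X : Type*} [MetricSpace X] [ProperSpace X] [MeasurableSpace X]
    [BorelSpace X] {A : Set X} (hA : IsClosed A) (hA' : A.Nonempty) :
    ∃ P : X → X, Measurable P ∧ ∀ x, P x ∈ A ∧ edist x (P x) = Metric.infEDist x A := by
  let Z : Set (X × X) := {z | z.2 ∈ A ∧ dist z.1 z.2 = Metric.infDist z.1 A}
  have hZ : IsClosed Z := (hA.preimage continuous_snd).inter (isClosed_eq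
    (continuous_fst.dist continuous_snd) ((Metric.continuous_infDist_pt A).comp continuous_fst))
  have : ProperSpace Z := ProperSpace.of_isClosed hZ
  obtain ⟨g, hg, hfg⟩ := exists_measurable_rightInverse (Z := Z) (Y := X) (f := fun z => z.1.1)
    (continuous_fst.comp continuous_subtype_val) (fun x => by
      obtain ⟨a, ha, hd⟩ := hA.exists_infDist_eq_dist hA' x
      exact ⟨⟨(x, a), ha, hd.symm⟩, rfl⟩)
  refine ⟨fun x => (g x).1.2, measurable_snd.comp (measurable_subtype_coe.comp hg), fun x =>
    ⟨(g x).2.1, ?_⟩⟩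
  have h := (g x).2.2
  rw [hfg x] at h
  rw [edist_dist, h, Metric.infDist, ENNReal.ofReal_toReal (Metric.infEDist_ne_top hA')]

/-! ### Geodesics of the base space -/

section BaseGeodesics

variable {X : Type*} [MetricSpace X]

theorem IsGeodesic.continuous {ξ : I → X} (h : IsGeodesic ξ) : Continuous ξ := by
  have : LipschitzWith (nndist (ξ 0) (ξ 1)) ξ := LipschitzWith.of_dist_le_mul fun s t => by
    rw [h s t, coe_nndist]; rfl
  exact this.continuous

/-- By the triangle inequality, a curve is a geodesic as soon as the distances along it are suitably
bounded from above. -/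
theorem isGeodesic_of_dist_le {Y : Type*} [PseudoMetricSpace Y] {ξ : I → Y}
    (h : ∀ s t : I, s ≤ t → dist (ξ s) (ξ t) ≤ dist (ξ 0) (ξ 1) * ((t : ℝ) - s)) :
    IsGeodesic ξ := by
  have key : ∀ s t : I, s ≤ t → dist (ξ s) (ξ t) = dist (ξ 0) (ξ 1) * ((t : ℝ) - s) := by
    intro s t hst
    refine le_antisymm (h s t hst) ?_
    have h0 := h 0 s s.2.1
    have h1 := h t 1 t.2.2
    have h2 := dist_triangle4 (ξ 0) (ξ s) (ξ t) (ξ 1)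
    simp only [Set.Icc.coe_zero, Set.Icc.coe_one] at h0 h1
    nlinarith
  intro s t
  rcases le_total s t with hst | hst
  · rw [key s t hst, abs_sub_comm, abs_of_nonneg (sub_nonneg.2 (Subtype.coe_le_coe.2 hst))]
  · rw [dist_comm, key t s hst, abs_of_nonneg (sub_nonneg.2 (Subtype.coe_le_coe.2 hst))]

/-- By the Arzelà–Ascoli theorem, the geodesics of a proper metric space form a proper metric space
for the uniform distance. -/
instance properSpace_geodesics [ProperSpace X] :
    ProperSpace {ξ : C(I, X) // IsGeodesic (ξ : I → X)} := by
  have hcomp : ∀ (x : X) (R : ℝ),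
      IsCompact {ξ : C(I, X) | IsGeodesic (ξ : I → X) ∧ ∀ t, ξ t ∈ Metric.closedBall x R} := by
    intro x R
    apply ArzelaAscoli.isCompact_of_equicontinuous
    · have : ContinuousMap.toFun '' {ξ : C(I, X) | IsGeodesic (ξ : I → X) ∧
          ∀ t, ξ t ∈ Metric.closedBall x R} =
          Set.pi Set.univ (fun _ : I => Metric.closedBall x R) ∩ {ξ : I → X | IsGeodesic ξ} := by
        ext ξ
        constructor
        · rintro ⟨ξ, ⟨h1, h2⟩, rfl⟩
          exact ⟨fun t _ => h2 t, h1⟩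
        · rintro ⟨h1, h2⟩
          exact ⟨⟨ξ, IsGeodesic.continuous h2⟩, ⟨h2, fun t => h1 t trivial⟩, rfl⟩
      rw [this]
      refine (isCompact_univ_pi fun _ => isCompact_closedBall x R).inter_right ?_
      simp only [IsGeodesic, Set.ofPred_forall]
      exact isClosed_iInter fun s => isClosed_iInter fun t =>
        isClosed_eq (by fun_prop) (by fun_prop)
    · have hl : ∀ ξ : {ξ : C(I, X) | IsGeodesic (ξ : I → X) ∧ ∀ t, ξ t ∈ Metric.closedBall x R},
          LipschitzWith (2 * R).toNNReal (ξ.1 : I → X) := by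
        rintro ⟨ξ, h1, h2⟩
        refine LipschitzWith.of_dist_le_mul fun s t => ?_
        rw [h1 s t]
        refine mul_le_mul_of_nonneg_right ?_ (abs_nonneg _)
        refine le_trans ?_ (Real.le_coe_toNNReal _)
        have := dist_triangle_right (ξ 0) (ξ 1) x
        have h3 : dist (ξ 0) x ≤ R := h2 0
        have h4 : dist (ξ 1) x ≤ R := h2 1
        linarith
      exact (LipschitzWith.uniformEquicontinuous _ _ hl).equicontinuous
  refine ⟨fun ξ r => ?_⟩
  rw [Subtype.isCompact_iff]
  obtain ⟨x, R, hR⟩ : ∃ (x : X) (R : ℝ), ∀ ζ : C(I, X), dist ζ ξ.1 ≤ r →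
      ∀ t, ζ t ∈ Metric.closedBall x R := by
    refine ⟨ξ.1 0, r + dist (ξ.1 0) (ξ.1 1), fun ζ hζ t => ?_⟩
    have h1 : dist (ζ t) (ξ.1 t) ≤ r := (ContinuousMap.dist_apply_le_dist t).trans hζ
    have h2 := ξ.2 t 0
    have h3 := dist_triangle (ζ t) (ξ.1 t) (ξ.1 0)
    have h4 : dist (ξ.1 0) (ξ.1 1) * |(t : ℝ) - ((0 : I) : ℝ)| ≤ dist (ξ.1 0) (ξ.1 1) := by
      refine mul_le_of_le_one_right dist_nonneg ?_
      simpa [abs_of_nonneg t.2.1] using t.2.2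
    rw [Metric.mem_closedBall]
    linarith
  have himage : Subtype.val '' Metric.closedBall ξ r =
      {ξ : C(I, X) | IsGeodesic (ξ : I → X) ∧ ∀ t, ξ t ∈ Metric.closedBall x R} ∩
        Metric.closedBall ξ.1 r := by
    ext ζ
    constructor
    · rintro ⟨ζ, hζ, rfl⟩
      exact ⟨⟨ζ.2, hR ζ.1 hζ⟩, hζ⟩
    · rintro ⟨⟨h1, -⟩, h2⟩
      exact ⟨⟨ζ, h1⟩, h2, rfl⟩
  rw [himage]
  exact (hcomp x R).inter_right Metric.isClosed_closedBall

/-- In a proper geodesic space, geodesics can be chosen in a measurable way. -/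
theorem exists_measurable_geodesics [ProperSpace X] [MeasurableSpace X] [BorelSpace X]
    (hX : IsGeodesicSpace X) :
    ∃ G : X × X → I → X, (∀ t, Measurable fun z => G z t) ∧
      ∀ z, IsGeodesic (G z) ∧ G z 0 = z.1 ∧ G z 1 = z.2 := by
  let _ : MeasurableSpace {ξ : C(I, X) // IsGeodesic (ξ : I → X)} := borel _
  have : BorelSpace {ξ : C(I, X) // IsGeodesic (ξ : I → X)} := ⟨rfl⟩
  obtain ⟨g, hg, hfg⟩ := exists_measurable_rightInverse
    (Z := {ξ : C(I, X) // IsGeodesic (ξ : I → X)}) (Y := X × X)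
    (f := fun ξ => (ξ.1 0, ξ.1 1)) (by fun_prop) (fun z => by
      obtain ⟨ξ, h0, h1⟩ := hX z.1 z.2
      exact ⟨⟨⟨ξ.1, IsGeodesic.continuous ξ.2⟩, ξ.2⟩, Prod.ext h0 h1⟩)
  refine ⟨fun z t => (g z).1 t, fun t => ?_, fun z => ⟨(g z).2, congrArg Prod.fst (hfg z),
    congrArg Prod.snd (hfg z)⟩⟩
  have : Continuous fun ξ : {ξ : C(I, X) // IsGeodesic (ξ : I → X)} => ξ.1 t := by fun_prop
  exact this.measurable.comp hg

/-- The form in which the non-branching assumption is used: a point `z` beyond `y` on a geodesic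
issuing from `x` is determined by `x`, `y` and the ratio of the distances. -/
theorem IsNonBranching.eq_of_aligned (hX : IsNonBranching X) {l : ℝ} (h0 : 0 < l) (h1 : l < 1)
    {x y z z' : X} (hxy : dist x y = l * dist x z) (hyz : dist y z = (1 - l) * dist x z)
    (hxy' : dist x y = l * dist x z') (hyz' : dist y z' = (1 - l) * dist x z') : z = z' := by
  obtain ⟨α, hα0, hα1⟩ := hX.1 x y
  -- For every such `z`, there is a geodesic from `x` to `z` that agrees with `α` up to time `l`.
  have key : ∀ z, dist x y = l * dist x z → dist y z = (1 - l) * dist x z →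
      ∃ ξ : Geo X, ξ.1 0 = x ∧ ξ.1 ⟨l, h0.le, h1.le⟩ = y ∧ ξ.1 1 = z := by
    intro z hxy hyz
    obtain ⟨β, hβ0, hβ1⟩ := hX.1 y z
    have hl : 0 < 1 - l := by linarith
    let a : I → I := fun s => Set.projIcc 0 1 zero_le_one (s / l)
    let b : I → I := fun s => Set.projIcc 0 1 zero_le_one ((s - l) / (1 - l))
    have ha : ∀ s : I, (s : ℝ) ≤ l → (a s : ℝ) = s / l := fun s hs => by
      simp only [a]
      rw [Set.projIcc_of_mem _ ⟨div_nonneg s.2.1 h0.le, (div_le_one h0).2 hs⟩]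
    have hb : ∀ s : I, l ≤ s → (b s : ℝ) = (s - l) / (1 - l) := fun s hs => by
      simp only [b]
      rw [Set.projIcc_of_mem _ ⟨div_nonneg (by linarith) hl.le,
        (div_le_one hl).2 (by linarith [s.2.2])⟩]
    let ξ : I → X := fun s => if (s : ℝ) ≤ l then α.1 (a s) else β.1 (b s)
    have hξα : ∀ s : I, (s : ℝ) ≤ l → ξ s = α.1 (a s) := fun s hs => if_pos hs
    have hξβ : ∀ s : I, l ≤ s → ξ s = β.1 (b s) := fun s hs => by
      rcases hs.eq_or_lt with h | h
      · have e1 : a s = 1 := Subtype.ext (by rw [ha s h.ge, ← h, div_self h0.ne']; rfl)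
        have e2 : b s = 0 := Subtype.ext (by rw [hb s hs, ← h, sub_self, zero_div]; rfl)
        rw [hξα s h.ge, e1, e2, hα1, hβ0]
      · exact if_neg (not_le.2 h)
    have x0 : ξ 0 = x := by
      have : a 0 = 0 := Subtype.ext (by rw [ha 0 h0.le]; simp)
      rw [hξα 0 h0.le, this, hα0]
    have xl : ξ ⟨l, h0.le, h1.le⟩ = y := by
      have : a ⟨l, h0.le, h1.le⟩ = 1 :=
        Subtype.ext (by rw [ha _ le_rfl]; exact div_self h0.ne')
      rw [hξα _ le_rfl, this, hα1]
    have x1 : ξ 1 = z := by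
      have : b 1 = 1 := Subtype.ext (by rw [hb 1 h1.le]; exact div_self hl.ne')
      rw [hξβ 1 h1.le, this, hβ1]
    have dα : ∀ s t : I, s ≤ t → (t : ℝ) ≤ l → dist (ξ s) (ξ t) = dist x z * ((t : ℝ) - s) := by
      intro s t hst ht
      have hst' : (s : ℝ) ≤ t := hst
      rw [hξα s (hst'.trans ht), hξα t ht, α.2 (a s) (a t), hα0, hα1, ha _ (hst'.trans ht), ha _ ht,
        hxy, abs_sub_comm, ← sub_div, abs_of_nonneg (div_nonneg (sub_nonneg.2 hst') h0.le)]
      field_simp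
    have dβ : ∀ s t : I, s ≤ t → l ≤ s → dist (ξ s) (ξ t) = dist x z * ((t : ℝ) - s) := by
      intro s t hst hs
      have hst' : (s : ℝ) ≤ t := hst
      rw [hξβ s hs, hξβ t (hs.trans hst'), β.2 (b s) (b t), hβ0, hβ1, hb _ (hs.trans hst'), hb _ hs,
        hyz, abs_sub_comm, ← sub_div, abs_of_nonneg (div_nonneg (by linarith) hl.le)]
      field_simp
      ring
    refine ⟨⟨ξ, isGeodesic_of_dist_le fun s t hst => ?_⟩, x0, xl, x1⟩
    rw [x0, x1]
    rcases le_total (t : ℝ) l with ht | ht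
    · exact (dα s t hst ht).le
    rcases le_total l (s : ℝ) with hs | hs
    · exact (dβ s t hst hs).le
    · have e1 := dα s ⟨l, h0.le, h1.le⟩ hs le_rfl
      have e2 := dβ ⟨l, h0.le, h1.le⟩ t ht le_rfl
      have := dist_triangle (ξ s) (ξ ⟨l, h0.le, h1.le⟩) (ξ t)
      simp only at e1 e2
      nlinarith
  obtain ⟨ξ, a0, al, a1⟩ := key z hxy hyz
  obtain ⟨ξ', b0, bl, b1⟩ := key z' hxy' hyz'
  have : ξ = ξ' := hX.2 ⟨l, h0.le, h1.le⟩ h0 h1 (Prod.ext (a0.trans b0.symm) (al.trans bl.symm))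
  rw [← a1, ← b1, this]

end BaseGeodesics

/-! ### Marginals and couplings -/

section Marginals

variable {X : Type*} [MeasurableSpace X] {A : Set X}
variable {Y Y' : Type*} [MeasurableSpace Y] [MeasurableSpace Y']

/-- The part in `Ω` of the image of the measure `ρ` under the map `a : Y → X`. -/
noncomputable def marg (A : Set X) (ρ : Measure Y) (a : Y → X) : Measure (Omega A) :=
  (ρ.map a).comap Subtype.val

theorem measurable_fst_eOmega : Measurable fun z : EOmega A => z.1.1 :=
  measurable_fst.comp measurable_subtype_coe

theorem measurable_snd_eOmega : Measurable fun z : EOmega A => z.1.2 :=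
  measurable_snd.comp measurable_subtype_coe

theorem measurableEmbedding_omega (hA : MeasurableSet A) :
    MeasurableEmbedding (Subtype.val : Omega A → X) :=
  MeasurableEmbedding.subtype_coe hA.compl

theorem marg_apply (hA : MeasurableSet A) (ρ : Measure Y) {a : Y → X} (ha : Measurable a)
    {s : Set (Omega A)} (hs : MeasurableSet s) :
    marg A ρ a s = ρ (a ⁻¹' (Subtype.val '' s)) := by
  have hv := measurableEmbedding_omega hA
  rw [marg, hv.comap_apply, Measure.map_apply ha (hv.measurableSet_image.2 hs)]

theorem lintegral_marg (hA : MeasurableSet A) (ρ : Measure Y) {a : Y → X} (ha : Measurable a)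
    {f : X → ℝ≥0∞} (hf : Measurable f) :
    ∫⁻ x, f x ∂marg A ρ a = ∫⁻ y in a ⁻¹' Aᶜ, f (a y) ∂ρ := by
  have hv := measurableEmbedding_omega hA
  rw [← hv.lintegral_map f, marg, hv.map_comap, Subtype.range_coe_subtype]
  exact setLIntegral_map hA.compl hf ha

theorem lintegral_marg_of_eq_zero (hA : MeasurableSet A) (ρ : Measure Y) {a : Y → X}
    (ha : Measurable a) {f : X → ℝ≥0∞} (hf : Measurable f) (hf0 : ∀ x ∈ A, f x = 0) :
    ∫⁻ x, f x ∂marg A ρ a = ∫⁻ y, f (a y) ∂ρ := by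
  rw [lintegral_marg hA ρ ha hf]
  refine setLIntegral_eq_of_support_subset fun y hy hyA => hy (hf0 _ hyA)

theorem marg_add (hA : MeasurableSet A) (ρ τ : Measure Y) {a : Y → X} (ha : Measurable a) :
    marg A (ρ + τ) a = marg A ρ a + marg A τ a := by
  ext s hs
  simp [marg_apply hA _ ha hs]

theorem marg_map (ρ : Measure Y) {g : Y → Y'} (hg : Measurable g)
    {a : Y' → X} (ha : Measurable a) : marg A (ρ.map g) a = marg A ρ (fun y => a (g y)) := by
  rw [marg, Measure.map_map ha hg]
  rfl

theorem marg_eq_zero (hA : MeasurableSet A) (ρ : Measure Y) {a : Y → X} (ha : Measurable a)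
    (h : ∀ᵐ y ∂ρ, a y ∈ A) : marg A ρ a = 0 := by
  rw [← Measure.measure_univ_eq_zero, marg_apply hA ρ ha MeasurableSet.univ]
  rw [ae_iff] at h
  refine measure_mono_null ?_ h
  rintro y ⟨x, -, hx⟩
  exact fun h => x.2 (hx ▸ h)

theorem marg_val (hA : MeasurableSet A) (μ : Measure (Omega A)) :
    marg A μ Subtype.val = μ := by
  ext s hs
  rw [marg_apply hA μ measurable_subtype_coe hs, Set.preimage_image_eq _ Subtype.val_injective]

/-- The part in `E_Ω` of the joint image of `ρ` under two maps `a, b : Y → X`. -/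
noncomputable def planOf (A : Set X) (ρ : Measure Y) (a b : Y → X) : Measure (EOmega A) :=
  (ρ.map fun y => (a y, b y)).comap Subtype.val

theorem measurableEmbedding_eOmega (hA : MeasurableSet A) :
    MeasurableEmbedding (Subtype.val : EOmega A → X × X) :=
  MeasurableEmbedding.subtype_coe (hA.prod hA).compl

theorem planOf_apply (hA : MeasurableSet A) (ρ : Measure Y) {a b : Y → X} (ha : Measurable a)
    (hb : Measurable b) {s : Set (EOmega A)} (hs : MeasurableSet s) :
    planOf A ρ a b s = ρ {y | (a y, b y) ∈ Subtype.val '' s} := by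
  have hv := measurableEmbedding_eOmega hA
  rw [planOf, hv.comap_apply, Measure.map_apply (ha.prodMk hb) (hv.measurableSet_image.2 hs)]
  rfl

theorem planOf_mem_Adm [MetricSpace X] (hA : MeasurableSet A) (ρ : Measure Y) {a b : Y → X}
    (ha : Measurable a) (hb : Measurable b) : planOf A ρ a b ∈ Adm (marg A ρ a) (marg A ρ b) := by
  constructor
  · change marg A (planOf A ρ a b) (fun z => z.1.1) = _
    ext s hs
    rw [marg_apply hA _ measurable_fst_eOmega hs, marg_apply hA _ ha hs, planOf_apply hA ρ ha hb
      (measurable_fst_eOmega ((measurableEmbedding_omega hA).measurableSet_image.2 hs))]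
    congr 1
    ext y
    constructor
    · rintro ⟨z, hz, hy⟩
      have h : z.1.1 = a y := congrArg Prod.fst hy
      rw [Set.mem_preimage, ← h]
      exact hz
    · intro hy
      refine ⟨⟨(a y, b y), fun h => ?_⟩, hy, rfl⟩
      obtain ⟨x, -, hx⟩ := hy
      exact x.2 (hx ▸ h.1)
  · change marg A (planOf A ρ a b) (fun z => z.1.2) = _
    ext s hs
    rw [marg_apply hA _ measurable_snd_eOmega hs, marg_apply hA _ hb hs, planOf_apply hA ρ ha hb
      (measurable_snd_eOmega ((measurableEmbedding_omega hA).measurableSet_image.2 hs))]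
    congr 1
    ext y
    constructor
    · rintro ⟨z, hz, hy⟩
      have h : z.1.2 = b y := congrArg Prod.snd hy
      rw [Set.mem_preimage, ← h]
      exact hz
    · intro hy
      refine ⟨⟨(a y, b y), fun h => ?_⟩, hy, rfl⟩
      obtain ⟨x, -, hx⟩ := hy
      exact x.2 (hx ▸ h.2)

end Marginals

section Couplings

variable {X : Type*} [MetricSpace X] [ProperSpace X] [MeasurableSpace X] [BorelSpace X] {A : Set X}
variable {Y : Type*} [MeasurableSpace Y] {p : ℝ}

theorem measurable_cost : Measurable fun z : EOmega A => edist z.1.1 z.1.2 ^ p :=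
  (measurable_fst_eOmega.edist measurable_snd_eOmega).pow_const p

theorem cost_planOf_le (hA : MeasurableSet A) (ρ : Measure Y) {a b : Y → X} (ha : Measurable a)
    (hb : Measurable b) : cost p (planOf A ρ a b) ≤ ∫⁻ y, edist (a y) (b y) ^ p ∂ρ := by
  have hv := measurableEmbedding_eOmega hA
  have hm : Measurable fun z : X × X => edist z.1 z.2 ^ p := measurable_edist.pow_const p
  rw [cost, ← hv.lintegral_map (fun z : X × X => edist z.1 z.2 ^ p), planOf, hv.map_comap]
  refine (setLIntegral_le_lintegral _ _).trans_eq ?_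
  rw [lintegral_map hm (ha.prodMk hb)]

theorem Wb_le_of_mem_Adm {μ ν : Measure (Omega A)} {γ : Measure (EOmega A)} (h : γ ∈ Adm μ ν) :
    Wb p μ ν ≤ cost p γ ^ (1 / p) :=
  iInf₂_le γ h

theorem Wb_pow_le_of_mem_Adm (hp : 0 < p) {μ ν : Measure (Omega A)} {γ : Measure (EOmega A)}
    (h : γ ∈ Adm μ ν) : Wb p μ ν ^ p ≤ cost p γ := by
  rw [ENNReal.le_rpow_inv_iff hp |>.symm, ← one_div]
  exact Wb_le_of_mem_Adm h

/-- Any measure `ρ` with two maps to `X` bounds the distance of the two marginals: mass that both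
maps send to `A` may be discarded. -/
theorem Wb_pow_marg_le (hA : MeasurableSet A) (hp : 0 < p) (ρ : Measure Y) {a b : Y → X}
    (ha : Measurable a) (hb : Measurable b) :
    Wb p (marg A ρ a) (marg A ρ b) ^ p ≤ ∫⁻ y, edist (a y) (b y) ^ p ∂ρ :=
  (Wb_pow_le_of_mem_Adm hp (planOf_mem_Adm hA ρ ha hb)).trans (cost_planOf_le hA ρ ha hb)

theorem Wb_marg_le (hA : MeasurableSet A) (hp : 0 < p) (ρ : Measure Y) {a b : Y → X}
    (ha : Measurable a) (hb : Measurable b) :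
    Wb p (marg A ρ a) (marg A ρ b) ≤ (∫⁻ y, edist (a y) (b y) ^ p ∂ρ) ^ (1 / p) := by
  rw [one_div, ENNReal.le_rpow_inv_iff hp]
  exact Wb_pow_marg_le hA hp ρ ha hb

theorem mem_Opt_iff (hp : 0 < p) {μ ν : Measure (Omega A)} {γ : Measure (EOmega A)} :
    γ ∈ Opt p μ ν ↔ γ ∈ Adm μ ν ∧ ∀ γ' ∈ Adm μ ν, cost p γ ≤ cost p γ' := by
  refine and_congr_right fun h => ⟨fun hγ γ' h' => hγ ▸ Wb_pow_le_of_mem_Adm hp h', fun hγ =>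
    le_antisymm ?_ (Wb_pow_le_of_mem_Adm hp h)⟩
  rw [← ENNReal.rpow_inv_le_iff hp, Wb]
  refine le_iInf₂ fun γ' h' => ?_
  rw [one_div]
  exact ENNReal.rpow_le_rpow (hγ γ' h') (inv_nonneg.2 hp.le)

/-- The exchange of the two coordinates. -/
def swapE : EOmega A → EOmega A := fun z => ⟨(z.1.2, z.1.1), fun h => z.2 ⟨h.2, h.1⟩⟩

theorem measurable_swapE : Measurable (swapE : EOmega A → EOmega A) :=
  (measurable_snd_eOmega.prodMk measurable_fst_eOmega).subtype_mk

theorem map_swapE_map_swapE (γ : Measure (EOmega A)) : (γ.map swapE).map swapE = γ := by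
  rw [Measure.map_map measurable_swapE measurable_swapE]
  exact Measure.map_id

theorem cost_map_swapE (γ : Measure (EOmega A)) : cost p (γ.map swapE) = cost p γ := by
  rw [cost, lintegral_map measurable_cost measurable_swapE]
  simp only [cost, swapE, edist_comm]

theorem map_swapE_mem_Adm {μ ν : Measure (Omega A)} {γ : Measure (EOmega A)}
    (h : γ ∈ Adm μ ν) : γ.map swapE ∈ Adm ν μ :=
  ⟨(marg_map γ measurable_swapE measurable_fst_eOmega).trans h.2,
    (marg_map γ measurable_swapE measurable_snd_eOmega).trans h.1⟩

theorem Wb_comm (μ ν : Measure (Omega A)) : Wb p μ ν = Wb p ν μ := by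
  have key : ∀ μ ν : Measure (Omega A), Wb p μ ν ≤ Wb p ν μ := fun μ ν => le_iInf₂ fun γ hγ => by
    rw [← cost_map_swapE γ]
    exact Wb_le_of_mem_Adm (map_swapE_mem_Adm hγ)
  exact le_antisymm (key μ ν) (key ν μ)

theorem map_swapE_mem_Opt {μ ν : Measure (Omega A)}
    {γ : Measure (EOmega A)} (h : γ ∈ Opt p μ ν) : γ.map swapE ∈ Opt p ν μ :=
  ⟨map_swapE_mem_Adm h.1, by rw [cost_map_swapE, h.2, Wb_comm]⟩

end Couplings

/-! ### Disintegration and gluing -/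

section Gluing

open ProbabilityTheory

/-- Disintegration of a measure on a product with respect to a σ-finite first marginal. -/
theorem exists_kernel_of_sigmaFinite_fst {α β : Type*} [MeasurableSpace α] [MeasurableSpace β]
    [StandardBorelSpace β] [Nonempty β] (ρ : Measure (α × β)) [SigmaFinite ρ.fst] :
    ∃ κ : Kernel α β, IsMarkovKernel κ ∧ ρ = ρ.fst ⊗ₘ κ := by
  -- The disintegration of finite measures applies after multiplication by an integrable density.
  obtain ⟨w, wpos, wm, wint⟩ := exists_pos_lintegral_lt_of_sigmaFinite ρ.fst one_ne_zero
  have hw : Measurable fun a => (w a : ℝ≥0∞) := wm.coe_nnreal_ennreal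
  have hw' : Measurable fun z : α × β => (w z.1 : ℝ≥0∞) := hw.comp measurable_fst
  let ρ' : Measure (α × β) := ρ.withDensity fun z => (w z.1 : ℝ≥0∞)
  have hfst : ∀ f : α → ℝ≥0∞, Measurable f → ∫⁻ a, f a ∂ρ'.fst = ∫⁻ a, w a * f a ∂ρ.fst := by
    intro f hf
    rw [Measure.fst, Measure.fst, lintegral_map hf measurable_fst,
      lintegral_map (f := fun a => w a * f a) (hw.mul hf) measurable_fst,
      lintegral_withDensity_eq_lintegral_mul (f := fun z : α × β => (w z.1 : ℝ≥0∞)) _ hw'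
        (g := fun z => f z.1) (hf.comp measurable_fst)]
    rfl
  have hfin : IsFiniteMeasure ρ' := by
    refine ⟨?_⟩
    rw [← Measure.fst_univ, ← lintegral_one, hfst _ measurable_const]
    simpa using wint.trans_le le_top
  have hww : ∀ a, (w a : ℝ≥0∞) * ((w a : ℝ≥0∞)⁻¹) = 1 := fun a =>
    ENNReal.mul_inv_cancel (by simpa using (wpos a).ne') ENNReal.coe_ne_top
  refine ⟨ρ'.condKernel, inferInstance, ?_⟩
  have : SFinite ρ.fst := inferInstance
  ext s hs
  have hg : Measurable fun z : α × β => (w z.1 : ℝ≥0∞)⁻¹ * s.indicator 1 z :=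
    hw'.inv.mul (measurable_one.indicator hs)
  have e1 : ∫⁻ z, (w z.1 : ℝ≥0∞)⁻¹ * s.indicator 1 z ∂ρ' = ρ s := by
    rw [lintegral_withDensity_eq_lintegral_mul _ hw' hg, ← lintegral_indicator_one hs]
    refine lintegral_congr fun z => ?_
    rw [Pi.mul_apply, ← mul_assoc, hww, one_mul]
  have e2 : ∫⁻ z, (w z.1 : ℝ≥0∞)⁻¹ * s.indicator 1 z ∂ρ' =
      ∫⁻ a, (w a : ℝ≥0∞)⁻¹ * ρ'.condKernel a (Prod.mk a ⁻¹' s) ∂ρ'.fst := by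
    conv_lhs => rw [← ρ'.disintegrate ρ'.condKernel]
    rw [Measure.lintegral_compProd hg]
    refine lintegral_congr fun a => ?_
    refine (lintegral_const_mul (w a : ℝ≥0∞)⁻¹ (f := fun b => s.indicator 1 (a, b))
      ((measurable_one.indicator hs).comp measurable_prodMk_left)).trans ?_
    rw [← lintegral_indicator_one (measurable_prodMk_left hs)]
    rfl
  rw [← e1, e2, hfst (fun a => (w a : ℝ≥0∞)⁻¹ * ρ'.condKernel a (Prod.mk a ⁻¹' s))
    (hw.inv.mul (Kernel.measurable_kernel_prodMk_left hs)),
    Measure.compProd_apply hs]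
  refine lintegral_congr fun a => ?_
  rw [← mul_assoc, hww, one_mul]

variable {X : Type*} [MetricSpace X] [ProperSpace X] [MeasurableSpace X] [BorelSpace X] {A : Set X}

/-- The inclusion of `Ω × X` in `E_Ω`. -/
def ofSource : Omega A × X → EOmega A := fun z => ⟨(z.1.1, z.2), fun h => z.1.2 h.1⟩

theorem measurable_ofSource : Measurable (ofSource : Omega A × X → EOmega A) :=
  ((measurable_subtype_coe.comp measurable_fst).prodMk measurable_snd).subtype_mk

theorem measurableEmbedding_ofSource (hA : MeasurableSet A) :
    MeasurableEmbedding (ofSource : Omega A × X → EOmega A) := by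
  have : StandardBorelSpace (Omega A) := hA.compl.standardBorel
  refine measurable_ofSource.measurableEmbedding fun z z' h => ?_
  have h' : ((z.1.1, z.2) : X × X) = (z'.1.1, z'.2) := congrArg Subtype.val h
  exact Prod.ext (Subtype.ext (Prod.ext_iff.1 h').1) (Prod.ext_iff.1 h').2

theorem range_ofSource : Set.range (ofSource : Omega A × X → EOmega A) = {z | z.1.1 ∈ A}ᶜ := by
  ext z
  constructor
  · rintro ⟨w, rfl⟩
    exact w.1.2
  · intro hz
    exact ⟨(⟨z.1.1, hz⟩, z.1.2), rfl⟩

theorem measurableSet_source (hA : MeasurableSet A) : MeasurableSet {z : EOmega A | z.1.1 ∈ A} :=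
  measurable_fst_eOmega hA

/-- Disintegration of a plan with respect to its source `μ`. The part of the plan with source in `A`
is kept apart, since it need not be σ-finite over its marginal. -/
theorem exists_kernel_of_mem_Adm [Nonempty X] (hA : MeasurableSet A) {μ ν : Measure (Omega A)}
    [SigmaFinite μ] {γ : Measure (EOmega A)} (h : γ ∈ Adm μ ν) :
    ∃ κ : Kernel (Omega A) X, IsMarkovKernel κ ∧
      γ = (μ ⊗ₘ κ).map ofSource + γ.restrict {z | z.1.1 ∈ A} := by
  have hj := measurableEmbedding_ofSource hA
  have hfst : (γ.comap ofSource).fst = μ := by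
    ext s hs
    have h1 : μ s = marg A γ (fun z => z.1.1) s := by rw [← h.1]; rfl
    rw [h1, marg_apply hA γ measurable_fst_eOmega hs, Measure.fst_apply hs, hj.comap_apply]
    congr 1
    ext z
    constructor
    · rintro ⟨w, hw, rfl⟩
      exact ⟨w.1, hw, rfl⟩
    · rintro ⟨y, hy, hyz⟩
      exact ⟨(y, z.1.2), hy, Subtype.ext (Prod.ext hyz rfl)⟩
  have : SigmaFinite (γ.comap ofSource).fst := by rw [hfst]; infer_instance
  obtain ⟨κ, hκ, hγ⟩ := exists_kernel_of_sigmaFinite_fst (γ.comap ofSource)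
  rw [hfst] at hγ
  refine ⟨κ, hκ, ?_⟩
  rw [← hγ, hj.map_comap, range_ofSource, add_comm,
    Measure.restrict_add_restrict_compl (measurableSet_source hA)]

/-- The gluing of two plans `γ`, `γ'` with the same source `ν`, given over `Ω` by the kernels `κ`,
`η` and over `A` by their restrictions. It lives on triples `(x, y, z)`, where `(y, x)` follows `γ`
and `(y, z)` follows `γ'`, independently given `y ∈ Ω`. Mass that one plan takes out of `y ∈ A` is
completed by the constant choice `y`, which costs nothing and does not affect the marginals. -/
noncomputable def glue (ν : Measure (Omega A)) (κ η : Kernel (Omega A) X)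
    (γ γ' : Measure (EOmega A)) : Measure (X × X × X) :=
  (ν ⊗ₘ (κ ×ₖ η)).map (fun w => (w.2.1, w.1.1, w.2.2)) +
    ((γ.restrict {z | z.1.1 ∈ A}).map (fun z => (z.1.2, z.1.1, z.1.1)) +
      (γ'.restrict {z | z.1.1 ∈ A}).map (fun z => (z.1.1, z.1.1, z.1.2)))

theorem measurable_glue_fst :
    Measurable fun w : Omega A × X × X => (w.2.1, w.1.1, w.2.2) := by fun_prop

theorem measurable_glue_snd :
    Measurable fun z : EOmega A => (z.1.2, z.1.1, z.1.1) := by fun_prop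

theorem measurable_glue_thd :
    Measurable fun z : EOmega A => (z.1.1, z.1.1, z.1.2) := by fun_prop

variable {ν : Measure (Omega A)} [SFinite ν] {κ η : Kernel (Omega A) X} [IsMarkovKernel κ]
  [IsMarkovKernel η] {γ γ' : Measure (EOmega A)}

theorem lintegral_glue_left (hA : MeasurableSet A)
    (h : γ = (ν ⊗ₘ κ).map ofSource + γ.restrict {z | z.1.1 ∈ A})
    {F : X × X → ℝ≥0∞} (hF : Measurable F) (hF0 : ∀ a ∈ A, F (a, a) = 0) :
    ∫⁻ t, F (t.2.1, t.1) ∂glue ν κ η γ γ' = ∫⁻ z, F z.1 ∂γ := by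
  have hF' : Measurable fun t : X × X × X => F (t.2.1, t.1) := by fun_prop
  have e3 : ∫⁻ z in {z : EOmega A | z.1.1 ∈ A}, F (z.1.1, z.1.1) ∂γ' = 0 :=
    setLIntegral_eq_zero (measurableSet_source hA) fun z hz => hF0 _ hz
  conv_rhs => rw [h, lintegral_add_measure, lintegral_map (by fun_prop) measurable_ofSource,
    Measure.lintegral_compProd (by unfold ofSource; fun_prop)]
  rw [glue, lintegral_add_measure, lintegral_add_measure, lintegral_map hF' measurable_glue_fst,
    lintegral_map hF' measurable_glue_snd, lintegral_map hF' measurable_glue_thd, e3, add_zero,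
    Measure.lintegral_compProd (by fun_prop)]
  congr 1
  refine lintegral_congr fun y => ?_
  rw [Kernel.prod_apply, lintegral_prod _ (by fun_prop)]
  simp [ofSource]

theorem lintegral_glue_right (hA : MeasurableSet A)
    (h : γ' = (ν ⊗ₘ η).map ofSource + γ'.restrict {z | z.1.1 ∈ A})
    {F : X × X → ℝ≥0∞} (hF : Measurable F) (hF0 : ∀ a ∈ A, F (a, a) = 0) :
    ∫⁻ t, F (t.2.1, t.2.2) ∂glue ν κ η γ γ' = ∫⁻ z, F z.1 ∂γ' := by
  have hF' : Measurable fun t : X × X × X => F (t.2.1, t.2.2) := by fun_prop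
  have e3 : ∫⁻ z in {z : EOmega A | z.1.1 ∈ A}, F (z.1.1, z.1.1) ∂γ = 0 :=
    setLIntegral_eq_zero (measurableSet_source hA) fun z hz => hF0 _ hz
  conv_rhs => rw [h, lintegral_add_measure, lintegral_map (by fun_prop) measurable_ofSource,
    Measure.lintegral_compProd (by unfold ofSource; fun_prop)]
  rw [glue, lintegral_add_measure, lintegral_add_measure, lintegral_map hF' measurable_glue_fst,
    lintegral_map hF' measurable_glue_snd, lintegral_map hF' measurable_glue_thd, e3, zero_add,
    Measure.lintegral_compProd (by fun_prop)]
  congr 1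
  refine lintegral_congr fun y => ?_
  rw [Kernel.prod_apply, lintegral_prod _ (by fun_prop)]
  simp [ofSource]

theorem marg_eq_marg {Y Y' : Type*} [MeasurableSpace Y] [MeasurableSpace Y'] (hA : MeasurableSet A)
    {ρ : Measure Y} {ρ' : Measure Y'} {a : Y → X} {b : Y' → X} (ha : Measurable a)
    (hb : Measurable b) (h : ∀ f : X → ℝ≥0∞, Measurable f → (∀ x ∈ A, f x = 0) →
      ∫⁻ y, f (a y) ∂ρ = ∫⁻ y, f (b y) ∂ρ') : marg A ρ a = marg A ρ' b := by
  ext s hs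
  have hs' := (measurableEmbedding_omega hA).measurableSet_image.2 hs
  have := h ((Subtype.val '' s).indicator 1) (measurable_one.indicator hs') fun x hx =>
    Set.indicator_of_notMem (by rintro ⟨y, -, rfl⟩; exact y.2 hx) _
  rw [marg_apply hA _ ha hs, marg_apply hA _ hb hs, ← lintegral_indicator_one (ha hs'),
    ← lintegral_indicator_one (hb hs')]
  exact this

theorem marg_glue_left (hA : MeasurableSet A)
    (h : γ = (ν ⊗ₘ κ).map ofSource + γ.restrict {z | z.1.1 ∈ A}) :
    marg A (glue ν κ η γ γ') (fun t => t.1) = marg A γ (fun z => z.1.2) :=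
  marg_eq_marg hA measurable_fst measurable_snd_eOmega fun _ hf hf0 =>
    lintegral_glue_left hA h (hf.comp measurable_snd) hf0

theorem marg_glue_right (hA : MeasurableSet A)
    (h : γ' = (ν ⊗ₘ η).map ofSource + γ'.restrict {z | z.1.1 ∈ A}) :
    marg A (glue ν κ η γ γ') (fun t => t.2.2) = marg A γ' (fun z => z.1.2) :=
  marg_eq_marg hA (measurable_snd.comp measurable_snd) measurable_snd_eOmega fun _ hf hf0 =>
    lintegral_glue_right hA h (hf.comp measurable_snd) hf0

end Gluing

section Triangle

variable {X : Type*} [MetricSpace X] [ProperSpace X] [MeasurableSpace X] [BorelSpace X] {A : Set X}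
variable {p : ℝ}

theorem Wb_triangle [Nonempty X] (hA : MeasurableSet A) (hp : 1 ≤ p)
    (μ ν τ : Measure (Omega A)) [SigmaFinite ν] : Wb p μ τ ≤ Wb p μ ν + Wb p ν τ := by
  have hp0 : 0 < p := zero_lt_one.trans_le hp
  rw [Wb_comm μ ν]
  refine ENNReal.le_iInf₂_add_iInf₂ fun γ hγ γ' hγ' => ?_
  obtain ⟨κ, hκ, h⟩ := exists_kernel_of_mem_Adm hA hγ
  obtain ⟨η, hη, h'⟩ := exists_kernel_of_mem_Adm hA hγ'
  have e1 : marg A (glue ν κ η γ γ') (fun t => t.1) = μ := (marg_glue_left hA h).trans hγ.2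
  have e2 : marg A (glue ν κ η γ γ') (fun t => t.2.2) = τ := (marg_glue_right hA h').trans hγ'.2
  have hm : Measurable fun z : X × X => edist z.1 z.2 ^ p := measurable_edist.pow_const p
  have hz : ∀ a ∈ A, edist a a ^ p = 0 := fun a _ => by simp [hp0]
  have c1 : ∫⁻ t, edist t.2.1 t.1 ^ p ∂glue ν κ η γ γ' = cost p γ :=
    lintegral_glue_left hA h hm hz
  have c2 : ∫⁻ t, edist t.2.1 t.2.2 ^ p ∂glue ν κ η γ γ' = cost p γ' :=
    lintegral_glue_right hA h' hm hz
  rw [← e1, ← e2, ← c1, ← c2]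
  have m1 : Measurable fun t : X × X × X => edist t.2.1 t.1 :=
    (measurable_fst.comp measurable_snd).edist measurable_fst
  have m2 : Measurable fun t : X × X × X => edist t.2.1 t.2.2 :=
    (measurable_fst.comp measurable_snd).edist (measurable_snd.comp measurable_snd)
  refine (Wb_marg_le hA hp0 _ measurable_fst (measurable_snd.comp measurable_snd)).trans ?_
  refine le_trans ?_ (ENNReal.lintegral_Lp_add_le m1.aemeasurable m2.aemeasurable hp)
  refine ENNReal.rpow_le_rpow (lintegral_mono fun t => ENNReal.rpow_le_rpow ?_ hp0.le)
    (by positivity)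
  simp only [Pi.add_apply]
  rw [edist_comm t.2.1 t.1]
  exact edist_triangle _ _ _

end Triangle

/-! ### Existence of optimal plans -/

section Radon

variable {X : Type*} [MetricSpace X] [ProperSpace X] [MeasurableSpace X] [BorelSpace X] {A : Set X}
variable {p : ℝ}

theorem locallyCompactSpace_omega (hA : IsClosed A) : LocallyCompactSpace (Omega A) :=
  hA.isOpen_compl.locallyCompactSpace

theorem sigmaFinite_of_isRadon (hA : IsClosed A) {μ : Measure (Omega A)} (hμ : IsRadon μ) :
    SigmaFinite μ := by
  have := locallyCompactSpace_omega hA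
  have : IsFiniteMeasureOnCompacts μ := ⟨fun K hK => hμ.finite_on_compacts K hK⟩
  have : IsLocallyFiniteMeasure μ := isLocallyFiniteMeasure_of_isFiniteMeasureOnCompacts
  infer_instance

/-- On `Ω`, the Radon property follows from the moment condition, because the distance to `A` is
bounded below by a positive constant on compact sets. -/
theorem isRadon_of_lintegral_lt_top (hA : IsClosed A) (hp : 0 < p)
    {μ : Measure (Omega A)} (hμ : ∫⁻ x, Metric.infEDist (x : X) A ^ p ∂μ < ∞) : IsRadon μ := by
  have := locallyCompactSpace_omega hA
  have hc : Continuous fun x : Omega A => Metric.infEDist (x : X) A :=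
    Metric.continuous_infEDist.comp continuous_subtype_val
  have hK : ∀ K : Set (Omega A), IsCompact K → μ K < ∞ := by
    intro K hK
    rcases K.eq_empty_or_nonempty with rfl | hne
    · simp
    obtain ⟨x, -, hx⟩ := hK.exists_isMinOn hne hc.continuousOn
    have hpos : Metric.infEDist (x : X) A ≠ 0 := fun h =>
      x.2 ((Metric.mem_iff_infEDist_zero_of_closed hA).2 h)
    have hne0 : Metric.infEDist (x : X) A ^ p ≠ 0 := by
      simp [ENNReal.rpow_eq_zero_iff, hpos, hp.not_gt]
    have h1 := mul_meas_ge_le_lintegral (μ := μ) (hc.measurable.pow_const p)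
      (Metric.infEDist (x : X) A ^ p)
    have h2 : K ⊆ {y : Omega A | Metric.infEDist (x : X) A ^ p ≤ Metric.infEDist (y : X) A ^ p} :=
      fun y hy => ENNReal.rpow_le_rpow (hx hy) hp.le
    refine (measure_mono h2).trans_lt (lt_top_iff_ne_top.2 fun h => ?_)
    rw [h, ENNReal.mul_top hne0] at h1
    exact absurd hμ (not_lt.2 h1)
  have : IsFiniteMeasureOnCompacts μ := ⟨fun K h => hK K h⟩
  have : IsLocallyFiniteMeasure μ := isLocallyFiniteMeasure_of_isFiniteMeasureOnCompacts
  have : μ.InnerRegular := inferInstance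
  exact ⟨hK, fun E hE => hE.measure_eq_iSup_isCompact μ⟩

end Radon

section Existence

variable {X : Type*} [MetricSpace X] [ProperSpace X] [MeasurableSpace X] [BorelSpace X] {A : Set X}
variable {p : ℝ}

/-- Sending all mass to nearest points of `A` shows that the distance of two elements of `M_p(X, A)`
is finite. -/
theorem exists_mem_Adm_cost_lt_top (hA : IsClosed A) (hA' : A.Nonempty) {μ ν : Measure (Omega A)}
    (hμ : ∫⁻ x, Metric.infEDist (x : X) A ^ p ∂μ < ∞)
    (hν : ∫⁻ x, Metric.infEDist (x : X) A ^ p ∂ν < ∞) : ∃ γ ∈ Adm μ ν, cost p γ < ∞ := by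
  have hm := hA.measurableSet
  obtain ⟨P, hP, hPA⟩ := exists_measurable_nearest hA hA'
  have hv : Measurable (Subtype.val : Omega A → X) := measurable_subtype_coe
  have m1 : Measurable fun x : Omega A => (x.1, P x.1) := hv.prodMk (hP.comp hv)
  have m2 : Measurable fun x : Omega A => (P x.1, x.1) := (hP.comp hv).prodMk hv
  let ρ : Measure (X × X) := μ.map (fun x => (x.1, P x.1)) + ν.map (fun x => (P x.1, x.1))
  have e1 : marg A ρ Prod.fst = μ := by
    rw [marg_add hm _ _ measurable_fst, marg_map _ m1 measurable_fst,
      marg_map _ m2 measurable_fst, marg_val hm,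
      marg_eq_zero hm ν (a := fun x => P x.1) (hP.comp hv) (ae_of_all _ fun x => (hPA _).1),
      add_zero]
  have e2 : marg A ρ Prod.snd = ν := by
    rw [marg_add hm _ _ measurable_snd, marg_map _ m1 measurable_snd,
      marg_map _ m2 measurable_snd, marg_val hm,
      marg_eq_zero hm μ (a := fun x => P x.1) (hP.comp hv) (ae_of_all _ fun x => (hPA _).1),
      zero_add]
  refine ⟨planOf A ρ Prod.fst Prod.snd, ?_, ?_⟩
  · have := planOf_mem_Adm hm ρ measurable_fst measurable_snd
    rwa [e1, e2] at this
  · refine (cost_planOf_le hm ρ measurable_fst measurable_snd).trans_lt ?_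
    have hc : Measurable fun z : X × X => edist z.1 z.2 ^ p := measurable_edist.pow_const p
    rw [lintegral_add_measure, lintegral_map hc m1, lintegral_map hc m2]
    simp only [edist_comm (P _), fun x : X => (hPA x).2]
    exact ENNReal.add_lt_top.2 ⟨hμ, hν⟩

/-- A continuous function on `X`, positive exactly on `Ω`, that is integrable for all measures in
`M_p(X, A)`. -/
noncomputable def weight (A : Set X) (p : ℝ) (x : X) : NNReal :=
  min 1 (Metric.infNndist x A ^ p)

theorem continuous_weight (hp : 0 < p) : Continuous (weight A p) :=
  continuous_const.min
    ((NNReal.continuous_rpow_const hp.le).comp (Metric.continuous_infNndist_pt A))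

theorem weight_le_one (x : X) : weight A p x ≤ 1 := min_le_left _ _

theorem weight_of_mem (hp : 0 < p) {x : X} (hx : x ∈ A) : weight A p x = 0 := by
  have : Metric.infNndist x A = 0 := by
    rw [← NNReal.coe_eq_zero, Metric.coe_infNndist, Metric.infDist_zero_of_mem hx]
  simp [weight, this, hp.ne']

theorem weight_pos (hA : IsClosed A) (hA' : A.Nonempty) {x : X} (hx : x ∉ A) :
    0 < weight A p x := by
  refine lt_min one_pos (NNReal.rpow_pos ?_)
  rw [← NNReal.coe_pos, Metric.coe_infNndist]
  exact (hA.notMem_iff_infDist_pos hA').1 hx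

theorem coe_weight_le (hA' : A.Nonempty) (hp : 0 < p) (x : X) :
    (weight A p x : ℝ≥0∞) ≤ Metric.infEDist x A ^ p := by
  have : (Metric.infNndist x A : ℝ≥0∞) = Metric.infEDist x A :=
    ENNReal.coe_toNNReal (Metric.infEDist_ne_top hA')
  rw [← this, ← ENNReal.coe_rpow_of_nonneg _ hp.le, ENNReal.coe_le_coe]
  exact min_le_right _ _

theorem lintegral_weight_lt_top (hA' : A.Nonempty) (hp : 0 < p) {μ : Measure (Omega A)}
    (hμ : ∫⁻ x, Metric.infEDist (x : X) A ^ p ∂μ < ∞) :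
    ∫⁻ x, (weight A p x.1 : ℝ≥0∞) ∂μ < ∞ :=
  lt_of_le_of_lt (lintegral_mono (g := fun x : Omega A => Metric.infEDist (x : X) A ^ p)
    fun x => coe_weight_le hA' hp x.1) hμ

/-- The weight on `E_Ω` that makes all plans between two given measures finite. -/
noncomputable def weightE (p : ℝ) (z : EOmega A) : NNReal := weight A p z.1.1 + weight A p z.1.2

theorem continuous_weightE (hp : 0 < p) : Continuous (weightE p : EOmega A → NNReal) :=
  ((continuous_weight hp).comp (continuous_fst.comp continuous_subtype_val)).add
    ((continuous_weight hp).comp (continuous_snd.comp continuous_subtype_val))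

theorem weightE_pos (hA : IsClosed A) (hA' : A.Nonempty) (z : EOmega A) : 0 < weightE p z := by
  by_cases h : z.1.1 ∈ A
  · exact add_pos_of_nonneg_of_pos zero_le (weight_pos hA hA' fun h' => z.2 ⟨h, h'⟩)
  · exact add_pos_of_pos_of_nonneg (weight_pos hA hA' h) zero_le

theorem lintegral_fst_of_mem_Adm (hA : MeasurableSet A) {μ ν : Measure (Omega A)}
    {γ : Measure (EOmega A)} (h : γ ∈ Adm μ ν) {f : X → ℝ≥0∞} (hf : Measurable f)
    (hf0 : ∀ x ∈ A, f x = 0) : ∫⁻ z, f z.1.1 ∂γ = ∫⁻ x, f x ∂μ := by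
  rw [← h.1]
  exact (lintegral_marg_of_eq_zero hA γ measurable_fst_eOmega hf hf0).symm

theorem lintegral_snd_of_mem_Adm (hA : MeasurableSet A) {μ ν : Measure (Omega A)}
    {γ : Measure (EOmega A)} (h : γ ∈ Adm μ ν) {f : X → ℝ≥0∞} (hf : Measurable f)
    (hf0 : ∀ x ∈ A, f x = 0) : ∫⁻ z, f z.1.2 ∂γ = ∫⁻ x, f x ∂ν := by
  rw [← h.2]
  exact (lintegral_marg_of_eq_zero hA γ measurable_snd_eOmega hf hf0).symm

theorem exists_isCompact_lintegral_compl_le (hA : IsClosed A) (hA' : A.Nonempty) (hp : 0 < p)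
    {μ : Measure (Omega A)} (hμ : ∫⁻ x, Metric.infEDist (x : X) A ^ p ∂μ < ∞) {ε : ℝ≥0∞}
    (hε : 0 < ε) :
    ∃ L : Set (Omega A), IsCompact L ∧ ∫⁻ x in Lᶜ, (weight A p x.1 : ℝ≥0∞) ∂μ ≤ ε := by
  have hw : Measurable fun x : Omega A => (weight A p x.1 : ℝ≥0∞) :=
    ((continuous_weight hp).measurable.comp measurable_subtype_coe).coe_nnreal_ennreal
  have : IsFiniteMeasure (μ.withDensity fun x => (weight A p x.1 : ℝ≥0∞)) :=
    isFiniteMeasure_withDensity (lintegral_weight_lt_top hA' hp hμ).ne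
  have : PolishSpace (Omega A) := hA.isOpen_compl.polishSpace
  obtain ⟨L, hL, h⟩ := isTightMeasureSet_iff_exists_isCompact_measure_compl_le.1
    (isTightMeasureSet_singleton (μ := μ.withDensity fun x => (weight A p x.1 : ℝ≥0∞))) ε hε
  refine ⟨L, hL, ?_⟩
  have h' := h _ (Set.mem_singleton _)
  rwa [withDensity_apply _ hL.measurableSet.compl] at h'

/-- The compact subsets of `E_Ω` used for tightness: pairs at bounded distance, one of whose entries
lies in a compact subset of `Ω`. -/
theorem isCompact_pairs {L : Set (Omega A)} (hL : IsCompact L) (R : ℝ) :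
    IsCompact {z : EOmega A | (z.1.1 ∈ Subtype.val '' L ∨ z.1.2 ∈ Subtype.val '' L) ∧
      dist z.1.1 z.1.2 ≤ R} := by
  have hL' : IsCompact (Subtype.val '' L : Set X) := hL.image continuous_subtype_val
  rw [Subtype.isCompact_iff]
  have himage : Subtype.val '' {z : EOmega A | (z.1.1 ∈ Subtype.val '' L ∨
      z.1.2 ∈ Subtype.val '' L) ∧ dist z.1.1 z.1.2 ≤ R} =
      {z : X × X | (z.1 ∈ Subtype.val '' L ∨ z.2 ∈ Subtype.val '' L) ∧ dist z.1 z.2 ≤ R} := by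
    ext z
    constructor
    · rintro ⟨z, hz, rfl⟩
      exact hz
    · rintro hz
      refine ⟨⟨z, fun h => ?_⟩, hz, rfl⟩
      rcases hz.1 with ⟨y, -, hy⟩ | ⟨y, -, hy⟩
      · exact y.2 (hy ▸ h.1)
      · exact y.2 (hy ▸ h.2)
  rw [himage]
  refine Metric.isCompact_of_isClosed_isBounded ?_ ?_
  · exact ((hL'.isClosed.preimage continuous_fst).union
      (hL'.isClosed.preimage continuous_snd)).inter
        (isClosed_le (continuous_fst.dist continuous_snd) continuous_const)
  · rcases isEmpty_or_nonempty X with hX | ⟨⟨x⟩⟩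
    · rw [Set.eq_empty_of_isEmpty {z : X × X | _}]
      exact Bornology.isBounded_empty
    obtain ⟨r, hr⟩ := hL'.isBounded.subset_closedBall x
    refine (Metric.isBounded_closedBall (x := (x, x)) (r := r + R)).subset ?_
    rintro z ⟨hz, hR⟩
    have hR' : dist z.1 z.2 ≤ R := hR
    rw [Metric.mem_closedBall, Prod.dist_eq]
    have hR0 : 0 ≤ R := dist_nonneg.trans hR'
    rcases hz with hz | hz
    · have h1 : dist z.1 x ≤ r := hr hz
      have h2 := dist_triangle_left z.2 x z.1
      exact max_le (by simpa using by linarith) (by simpa using by linarith)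
    · have h1 : dist z.2 x ≤ r := hr hz
      have h2 := dist_triangle z.1 z.2 x
      exact max_le (by simpa using by linarith) (by simpa using by linarith)

/-- A bounded continuous function with values in `ℝ≥0`. -/
def boundedOfLe {E : Type*} [TopologicalSpace E] {g : E → NNReal} (hg : Continuous g) (B : NNReal)
    (hB : ∀ z, g z ≤ B) : BoundedContinuousFunction E NNReal :=
  BoundedContinuousFunction.mkOfBound ⟨g, hg⟩ B fun x y => by
    have h1 : (g x : ℝ) ≤ B := hB x
    have h2 : (g y : ℝ) ≤ B := hB y
    have h3 := (g x).2
    have h4 := (g y).2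
    change |(g x : ℝ) - g y| ≤ B
    exact abs_le.2 ⟨by linarith, by linarith⟩

/-- The integral of a non-negative, possibly unbounded continuous function is a supremum of
integrals of bounded ones, hence lower semicontinuous in the measure. -/
theorem lowerSemicontinuous_lintegral {E : Type*} [TopologicalSpace E] [MeasurableSpace E]
    [BorelSpace E] {c : E → NNReal} (hc : Continuous c) :
    LowerSemicontinuous fun ρ : FiniteMeasure E => ∫⁻ z, c z ∂(ρ : Measure E) := by
  let b : ℕ → BoundedContinuousFunction E NNReal := fun n =>
    boundedOfLe (continuous_const.min hc) n fun _ => min_le_left _ _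
  have hb : ∀ n z, b n z = min (n : NNReal) (c z) := fun _ _ => rfl
  have key : ∀ ρ : FiniteMeasure E, ∫⁻ z, c z ∂(ρ : Measure E) =
      ⨆ n, (ρ.testAgainstNN (b n) : ℝ≥0∞) := by
    intro ρ
    simp only [FiniteMeasure.testAgainstNN_coe_eq]
    rw [← lintegral_iSup (fun n => (b n).continuous.measurable.coe_nnreal_ennreal)
      (fun m n hmn z => ENNReal.coe_le_coe.2 (min_le_min_right _ (Nat.cast_le.2 hmn)))]
    refine lintegral_congr fun z => le_antisymm ?_ (iSup_le fun n =>
      ENNReal.coe_le_coe.2 (min_le_right _ _))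
    obtain ⟨n, hn⟩ := exists_nat_ge (c z)
    refine le_iSup_of_le n ?_
    rw [hb, min_eq_right hn]
  simp only [key]
  exact lowerSemicontinuous_iSup fun n => (ENNReal.continuous_coe.comp
    (FiniteMeasure.continuous_testAgainstNN_eval (b n))).lowerSemicontinuous

/-- The condition that, after division of `ρ` by `weightE`, its image under `π` restricts to `μ` on
`Ω` can be tested with bounded continuous functions, multiplied by the weight. -/
theorem marg_withDensity_eq (hA : IsClosed A) (hA' : A.Nonempty) (hp : 0 < p)
    {μ : Measure (Omega A)} (hμ : ∫⁻ x, (weight A p x.1 : ℝ≥0∞) ∂μ < ∞)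
    {ρ : Measure (EOmega A)} {π : EOmega A → X} (hπ : Measurable π)
    (h : ∀ f : BoundedContinuousFunction X NNReal,
      ∫⁻ z, (weight A p (π z) : ℝ≥0∞) / weightE p z * f (π z) ∂ρ =
        ∫⁻ x, (weight A p x.1 : ℝ≥0∞) * f x.1 ∂μ) :
    marg A (ρ.withDensity fun z => (weightE p z : ℝ≥0∞)⁻¹) π = μ := by
  have hm := hA.measurableSet
  have hv : Measurable (Subtype.val : Omega A → X) := measurable_subtype_coe
  have hhm : Measurable fun x : X => (weight A p x : ℝ≥0∞) :=
    (continuous_weight hp).measurable.coe_nnreal_ennreal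
  have hwm : Measurable fun z : EOmega A => (weightE p z : ℝ≥0∞) :=
    (continuous_weightE hp).measurable.coe_nnreal_ennreal
  let τ₁ : Measure X :=
    (ρ.withDensity fun z => (weight A p (π z) : ℝ≥0∞) / weightE p z).map π
  let τ₂ : Measure X := (μ.withDensity fun x => (weight A p x.1 : ℝ≥0∞)).map Subtype.val
  have h1 : ∀ g : X → ℝ≥0∞, Measurable g →
      ∫⁻ x, g x ∂τ₁ = ∫⁻ z, (weight A p (π z) : ℝ≥0∞) / weightE p z * g (π z) ∂ρ := fun g hg => by
    rw [lintegral_map hg hπ]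
    exact lintegral_withDensity_eq_lintegral_mul _ ((hhm.comp hπ).div hwm) (hg.comp hπ)
  have h2 : ∀ g : X → ℝ≥0∞, Measurable g →
      ∫⁻ x, g x ∂τ₂ = ∫⁻ x, (weight A p x.1 : ℝ≥0∞) * g x.1 ∂μ := fun g hg => by
    rw [lintegral_map hg hv]
    exact lintegral_withDensity_eq_lintegral_mul _ (hhm.comp hv) (hg.comp hv)
  have : IsFiniteMeasure (μ.withDensity fun x => (weight A p x.1 : ℝ≥0∞)) :=
    isFiniteMeasure_withDensity hμ.ne
  have : IsFiniteMeasure τ₂ := inferInstance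
  have heq : τ₂ = τ₁ := by
    refine ext_of_forall_lintegral_eq_of_IsFiniteMeasure fun f => ?_
    have hf : Measurable fun x => (f x : ℝ≥0∞) := f.continuous.measurable.coe_nnreal_ennreal
    rw [h1 _ hf, h2 _ hf, h f]
  rw [← marg_val hm μ]
  refine marg_eq_marg hm hπ hv fun f hf hf0 => ?_
  have hfh : Measurable fun x => f x * (weight A p x : ℝ≥0∞)⁻¹ := hf.mul hhm.inv
  -- Off `A` the weight is invertible, and on `A` both integrands vanish.
  have hcancel : ∀ x, (weight A p x : ℝ≥0∞) * (f x * (weight A p x : ℝ≥0∞)⁻¹) = f x := fun x => by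
    by_cases hx : x ∈ A
    · rw [hf0 x hx, zero_mul, mul_zero]
    · rw [mul_left_comm, ENNReal.mul_inv_cancel
        (ENNReal.coe_ne_zero.2 (weight_pos hA hA' hx).ne') ENNReal.coe_ne_top, mul_one]
  have e1 : ∫⁻ z, f (π z) ∂ρ.withDensity (fun z => (weightE p z : ℝ≥0∞)⁻¹) =
      ∫⁻ z, (weightE p z : ℝ≥0∞)⁻¹ * f (π z) ∂ρ :=
    lintegral_withDensity_eq_lintegral_mul _ hwm.inv (hf.comp hπ)
  calc _ = ∫⁻ x, f x * (weight A p x : ℝ≥0∞)⁻¹ ∂τ₁ := by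
        rw [e1, h1 _ hfh]
        refine lintegral_congr fun z => ?_
        rw [div_eq_mul_inv, mul_comm (weight A p (π z) : ℝ≥0∞), mul_assoc, hcancel]
    _ = _ := by
        rw [← heq, h2 _ hfh]
        exact lintegral_congr fun x => hcancel x.1

/-- Optimal plans exist. With `h` for `weight` and `w(x, y) = h(x) + h(y)` for `weightE`, the
measures `w γ`, for the plans `γ` of bounded cost, form a tight family of constant mass. The
marginal constraints pass to weak limits since they can be tested with the bounded continuous
functions `f(x) h(x) / w(x, y)` and `f(y) h(y) / w(x, y)`. -/
theorem exists_mem_Opt (hA : IsClosed A) (hA' : A.Nonempty) (hp : 0 < p) {μ ν : Measure (Omega A)}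
    (hμ : ∫⁻ x, Metric.infEDist (x : X) A ^ p ∂μ < ∞)
    (hν : ∫⁻ x, Metric.infEDist (x : X) A ^ p ∂ν < ∞) :
    ∃ γ, γ ∈ Opt p μ ν ∧ cost p γ < ∞ := by
  have hm := hA.measurableSet
  have hhm : Measurable fun x : X => (weight A p x : ℝ≥0∞) :=
    (continuous_weight hp).measurable.coe_nnreal_ennreal
  have hh0 : ∀ x ∈ A, (weight A p x : ℝ≥0∞) = 0 := fun x hx => by rw [weight_of_mem hp hx]; rfl
  have hwm : Measurable fun z : EOmega A => (weightE p z : ℝ≥0∞) :=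
    (continuous_weightE hp).measurable.coe_nnreal_ennreal
  have hw0 : ∀ z : EOmega A, (weightE p z : ℝ≥0∞) ≠ 0 := fun z =>
    ENNReal.coe_ne_zero.2 (weightE_pos hA hA' z).ne'
  have hwi : ∀ z : EOmega A, (weightE p z : ℝ≥0∞) * (weightE p z : ℝ≥0∞)⁻¹ = 1 := fun z =>
    ENNReal.mul_inv_cancel (hw0 z) ENNReal.coe_ne_top
  obtain ⟨γ₀, hγ₀, hfin⟩ := exists_mem_Adm_cost_lt_top hA hA' hμ hν
  let M : ℝ≥0∞ := ∫⁻ x, (weight A p x.1 : ℝ≥0∞) ∂μ + ∫⁻ x, (weight A p x.1 : ℝ≥0∞) ∂ν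
  have hM : M < ∞ := ENNReal.add_lt_top.2
    ⟨lintegral_weight_lt_top hA' hp hμ, lintegral_weight_lt_top hA' hp hν⟩
  -- The weighted plans `w γ` all have the mass `M`.
  have hmass : ∀ γ ∈ Adm μ ν, ∫⁻ z, (weightE p z : ℝ≥0∞) ∂γ = M := by
    intro γ hγ
    simp only [weightE, ENNReal.coe_add]
    rw [lintegral_add_left (f := fun z : EOmega A => (weight A p z.1.1 : ℝ≥0∞))
      (hhm.comp measurable_fst_eOmega),
      lintegral_fst_of_mem_Adm hm hγ hhm hh0, lintegral_snd_of_mem_Adm hm hγ hhm hh0]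
  let R : Measure (EOmega A) → Measure (EOmega A) := fun γ =>
    γ.withDensity fun z => (weightE p z : ℝ≥0∞)
  have hRfin : ∀ γ ∈ Adm μ ν, IsFiniteMeasure (R γ) := fun γ hγ =>
    isFiniteMeasure_withDensity (by rw [hmass γ hγ]; exact hM.ne)
  have hRint : ∀ (γ : Measure (EOmega A)) (F : EOmega A → ℝ≥0∞), Measurable F →
      ∫⁻ z, F z ∂(R γ) = ∫⁻ z, weightE p z * F z ∂γ := fun γ F hF =>
    lintegral_withDensity_eq_lintegral_mul _ hwm hF
  -- Compact sets that carry all but a small part of the mass, uniformly in the plan.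
  let C : ℝ≥0∞ := cost p γ₀
  let δ : ℕ → ℝ≥0∞ := fun n => ((n : ℝ≥0∞) + 1)⁻¹
  have hδ : ∀ n, 0 < δ n := fun n => by simp [δ]
  choose L₁ hL₁ hL₁' using fun n => exists_isCompact_lintegral_compl_le hA hA' hp hμ (hδ n)
  choose L₂ hL₂ hL₂' using fun n => exists_isCompact_lintegral_compl_le hA hA' hp hν (hδ n)
  let K : ℕ → Set (EOmega A) := fun n =>
    {z | (z.1.1 ∈ Subtype.val '' (L₁ n ∪ L₂ n) ∨ z.1.2 ∈ Subtype.val '' (L₁ n ∪ L₂ n)) ∧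
      dist z.1.1 z.1.2 ≤ ((n : ℝ) + 1) ^ (1 / p)}
  have hK : ∀ n, IsCompact (K n) := fun n => isCompact_pairs ((hL₁ n).union (hL₂ n)) _
  let u : ℕ → NNReal := fun n => ((2 * C + 2) * δ n).toNNReal
  have hC2 : 2 * C + 2 ≠ ∞ := by finiteness [hfin.ne]
  have hu' : ∀ n, (u n : ℝ≥0∞) = (2 * C + 2) * δ n := fun n =>
    ENNReal.coe_toNNReal (ENNReal.mul_ne_top hC2 (by simp [δ]))
  have hu : Filter.Tendsto u Filter.atTop (nhds 0) := by
    rw [← ENNReal.tendsto_coe]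
    simp only [hu']
    have h1 : Filter.Tendsto δ Filter.atTop (nhds 0) := by
      have := (Filter.tendsto_add_atTop_iff_nat 1).2 ENNReal.tendsto_inv_nat_nhds_zero
      simpa [δ] using this
    simpa using ENNReal.Tendsto.const_mul h1 (Or.inr hC2)
  have htail : ∀ γ ∈ Adm μ ν, cost p γ ≤ C → ∀ n, R γ (K n)ᶜ ≤ u n := by
    intro γ hγ hγC n
    let f₁ : X → ℝ≥0∞ := (Subtype.val '' (L₁ n)ᶜ).indicator fun x => (weight A p x : ℝ≥0∞)
    let f₂ : X → ℝ≥0∞ := (Subtype.val '' (L₂ n)ᶜ).indicator fun x => (weight A p x : ℝ≥0∞)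
    have hv := measurableEmbedding_omega hm
    have hf₁ : Measurable f₁ :=
      hhm.indicator (hv.measurableSet_image.2 (hL₁ n).measurableSet.compl)
    have hf₂ : Measurable f₂ :=
      hhm.indicator (hv.measurableSet_image.2 (hL₂ n).measurableSet.compl)
    have i₁ : ∫⁻ z, f₁ z.1.1 ∂γ ≤ δ n := by
      rw [lintegral_fst_of_mem_Adm hm hγ hf₁ fun x hx => Set.indicator_apply_eq_zero.2
        fun _ => hh0 x hx]
      refine le_trans (le_of_eq ?_) (hL₁' n)
      rw [← lintegral_indicator (hL₁ n).measurableSet.compl]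
      exact lintegral_congr fun x => Set.indicator_image Subtype.val_injective
    have i₂ : ∫⁻ z, f₂ z.1.2 ∂γ ≤ δ n := by
      rw [lintegral_snd_of_mem_Adm hm hγ hf₂ fun x hx => Set.indicator_apply_eq_zero.2
        fun _ => hh0 x hx]
      refine le_trans (le_of_eq ?_) (hL₂' n)
      rw [← lintegral_indicator (hL₂ n).measurableSet.compl]
      exact lintegral_congr fun x => Set.indicator_image Subtype.val_injective
    have hpt : ∀ z : EOmega A, (K n)ᶜ.indicator (fun z => (weightE p z : ℝ≥0∞)) z ≤
        2 * δ n * edist z.1.1 z.1.2 ^ p + (f₁ z.1.1 + f₂ z.1.2) := by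
      intro z
      by_cases hz : z ∈ (K n)ᶜ
      swap
      · rw [Set.indicator_of_notMem hz]
        exact zero_le
      rw [Set.indicator_of_mem hz]
      by_cases hd : dist z.1.1 z.1.2 ≤ ((n : ℝ) + 1) ^ (1 / p)
      · -- Neither entry of the pair lies in the compact set.
        have hz' : ¬(z.1.1 ∈ Subtype.val '' (L₁ n ∪ L₂ n) ∨
          z.1.2 ∈ Subtype.val '' (L₁ n ∪ L₂ n)) := fun h => hz ⟨h, hd⟩
        rw [not_or] at hz'
        refine le_trans ?_ le_add_self
        simp only [weightE, ENNReal.coe_add]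
        refine add_le_add ?_ ?_
        · by_cases hx : z.1.1 ∈ A
          · rw [hh0 _ hx]; exact zero_le
          · have hx' : z.1.1 ∈ Subtype.val '' (L₁ n)ᶜ :=
              ⟨⟨z.1.1, hx⟩, fun h => hz'.1 ⟨_, Or.inl h, rfl⟩, rfl⟩
            exact (Set.indicator_of_mem hx' fun x : X => (weight A p x : ℝ≥0∞)).ge
        · by_cases hx : z.1.2 ∈ A
          · rw [hh0 _ hx]; exact zero_le
          · have hx' : z.1.2 ∈ Subtype.val '' (L₂ n)ᶜ :=
              ⟨⟨z.1.2, hx⟩, fun h => hz'.2 ⟨_, Or.inr h, rfl⟩, rfl⟩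
            exact (Set.indicator_of_mem hx' fun x : X => (weight A p x : ℝ≥0∞)).ge
      · -- The entries are far apart, and the weight is at most `2`.
        refine le_trans ?_ le_self_add
        have h1 : (n : ℝ≥0∞) + 1 ≤ edist z.1.1 z.1.2 ^ p := by
          have hn : (0 : ℝ) ≤ (n : ℝ) + 1 := by positivity
          have h2 : (n : ℝ) + 1 ≤ dist z.1.1 z.1.2 ^ p := by
            have := Real.rpow_le_rpow (by positivity) (not_le.1 hd).le hp.le
            rwa [one_div, Real.rpow_inv_rpow hn hp.ne'] at this
          rw [edist_dist, ENNReal.ofReal_rpow_of_nonneg dist_nonneg hp.le]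
          refine le_trans ?_ (ENNReal.ofReal_le_ofReal h2)
          rw [ENNReal.ofReal_add (by positivity) zero_le_one]
          simp
        have h3 : (weightE p z : ℝ≥0∞) ≤ 2 := by
          have := add_le_add (weight_le_one (A := A) (p := p) z.1.1)
            (weight_le_one (A := A) (p := p) z.1.2)
          rw [one_add_one_eq_two] at this
          exact_mod_cast this
        calc (weightE p z : ℝ≥0∞) ≤ 2 * (δ n * (n + 1)) := by
              rw [ENNReal.inv_mul_cancel (by simp) (by finiteness), mul_one]
              exact h3
          _ ≤ _ := by
              rw [mul_assoc]
              gcongr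
    have hKm : MeasurableSet (K n)ᶜ := (hK n).measurableSet.compl
    calc R γ (K n)ᶜ = ∫⁻ z, (K n)ᶜ.indicator (fun z => (weightE p z : ℝ≥0∞)) z ∂γ := by
          rw [withDensity_apply _ hKm, lintegral_indicator hKm]
      _ ≤ ∫⁻ z, (2 * δ n * edist z.1.1 z.1.2 ^ p + (f₁ z.1.1 + f₂ z.1.2)) ∂γ := lintegral_mono hpt
      _ = 2 * δ n * cost p γ + (∫⁻ z, f₁ z.1.1 ∂γ + ∫⁻ z, f₂ z.1.2 ∂γ) := by
          rw [lintegral_add_left (measurable_cost.const_mul _),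
            lintegral_add_left (f := fun z : EOmega A => f₁ z.1.1) (hf₁.comp measurable_fst_eOmega),
            lintegral_const_mul _ measurable_cost]
          rfl
      _ ≤ 2 * δ n * C + (δ n + δ n) := by gcongr
      _ = u n := by rw [hu']; ring
  -- The marginal constraints amount to prescribed integrals of the functions `b₁ f`, `b₂ f`.
  have htest : ∀ π : EOmega A → X, Continuous π → (∀ z, weight A p (π z) ≤ weightE p z) →
      ∀ f : BoundedContinuousFunction X NNReal, ∃ b : BoundedContinuousFunction (EOmega A) NNReal,
        ∀ z, b z = weight A p (π z) / weightE p z * f (π z) := by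
    intro π hπ hle f
    refine ⟨boundedOfLe (g := fun z => weight A p (π z) / weightE p z * f (π z)) ?_
      (1 * nndist f 0) fun z => ?_, fun z => rfl⟩
    · exact (((continuous_weight hp).comp hπ).div (continuous_weightE hp)
        fun z => (weightE_pos hA hA' z).ne').mul (f.continuous.comp hπ)
    · exact mul_le_mul' (div_le_one_of_le₀ (hle z) zero_le)
        (BoundedContinuousFunction.NNReal.upper_bound f _)
  have cont₁ : Continuous fun z : EOmega A => z.1.1 := continuous_fst.comp continuous_subtype_val
  have cont₂ : Continuous fun z : EOmega A => z.1.2 := continuous_snd.comp continuous_subtype_val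
  choose b₁ hb₁ using htest (fun z => z.1.1) cont₁ fun z => le_self_add
  choose b₂ hb₂ using htest (fun z => z.1.2) cont₂ fun z => le_add_self
  have hb₁' : ∀ f z, (b₁ f z : ℝ≥0∞) = weight A p z.1.1 / weightE p z * f z.1.1 := fun f z => by
    rw [hb₁, ENNReal.coe_mul, ENNReal.coe_div (weightE_pos hA hA' z).ne']
  have hb₂' : ∀ f z, (b₂ f z : ℝ≥0∞) = weight A p z.1.2 / weightE p z * f z.1.2 := fun f z => by
    rw [hb₂, ENNReal.coe_mul, ENNReal.coe_div (weightE_pos hA hA' z).ne']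
  have hfin' : ∀ (τ : Measure (Omega A)), ∫⁻ x, (weight A p x.1 : ℝ≥0∞) ∂τ < ∞ →
      ∀ f : BoundedContinuousFunction X NNReal,
        ∫⁻ x, (weight A p x.1 : ℝ≥0∞) * f x.1 ∂τ ≠ ∞ := by
    intro τ hτ f
    refine ((lintegral_mono (g := fun x : Omega A => (weight A p x.1 : ℝ≥0∞) * nndist f 0)
      fun x => mul_le_mul_right ?_ _).trans_lt ?_).ne
    · exact ENNReal.coe_le_coe.2 (BoundedContinuousFunction.NNReal.upper_bound f _)
    · rw [lintegral_mul_const _ (f := fun x : Omega A => (weight A p x.1 : ℝ≥0∞))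
        (hhm.comp measurable_subtype_coe)]
      exact ENNReal.mul_lt_top hτ ENNReal.coe_lt_top
  let S : Set (FiniteMeasure (EOmega A)) := {ρ | ρ.mass ≤ M.toNNReal ∧ ∀ n, ρ (K n)ᶜ ≤ u n}
  have hS : IsCompact S := isCompact_setOfPred_finiteMeasure_mass_le_compl_isCompact_le
    M.toNNReal hu hK (Or.inl inferInstance)
  let T : Set (FiniteMeasure (EOmega A)) := {ρ | ∀ f,
    ρ.testAgainstNN (b₁ f) = (∫⁻ x, (weight A p x.1 : ℝ≥0∞) * f x.1 ∂μ).toNNReal ∧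
    ρ.testAgainstNN (b₂ f) = (∫⁻ x, (weight A p x.1 : ℝ≥0∞) * f x.1 ∂ν).toNNReal}
  have hT : IsClosed T := by
    simp only [T, Set.ofPred_forall]
    exact isClosed_iInter fun f =>
      (isClosed_eq (FiniteMeasure.continuous_testAgainstNN_eval _) continuous_const).inter
        (isClosed_eq (FiniteMeasure.continuous_testAgainstNN_eval _) continuous_const)
  -- The cost, as a function of the weighted plan.
  let c : EOmega A → NNReal := fun z => nndist z.1.1 z.1.2 ^ p / weightE p z
  have hc : Continuous c := ((NNReal.continuous_rpow_const hp.le).comp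
    (cont₁.nndist cont₂)).div (continuous_weightE hp) fun z => (weightE_pos hA hA' z).ne'
  have hcw : ∀ z, (c z : ℝ≥0∞) = (weightE p z : ℝ≥0∞)⁻¹ * edist z.1.1 z.1.2 ^ p := fun z => by
    rw [ENNReal.coe_div (weightE_pos hA hA' z).ne', ENNReal.coe_rpow_of_nonneg _ hp.le,
      ← edist_nndist, div_eq_mul_inv, mul_comm]
  have hRcost : ∀ γ, ∫⁻ z, c z ∂(R γ) = cost p γ := by
    intro γ
    rw [hRint γ _ hc.measurable.coe_nnreal_ennreal]
    refine lintegral_congr fun z => ?_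
    rw [hcw, ← mul_assoc, hwi, one_mul]
  let RF : ∀ γ ∈ Adm μ ν, FiniteMeasure (EOmega A) := fun γ hγ => ⟨R γ, hRfin γ hγ⟩
  have hmem : ∀ γ (hγ : γ ∈ Adm μ ν), cost p γ ≤ C → RF γ hγ ∈ S ∩ T := by
    intro γ hγ hγC
    have hwc : ∀ (x : X) (z : EOmega A) (r : ℝ≥0∞),
        (weightE p z : ℝ≥0∞) * ((weight A p x : ℝ≥0∞) / weightE p z * r) = weight A p x * r := by
      intro x z r
      rw [← mul_assoc, ENNReal.mul_div_cancel (hw0 z) ENNReal.coe_ne_top]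
    refine ⟨⟨ENNReal.toNNReal_mono hM.ne ?_, fun n => ?_⟩, fun f => ⟨?_, ?_⟩⟩
    · rw [← hmass γ hγ]
      exact (withDensity_apply _ MeasurableSet.univ).le.trans (setLIntegral_univ _).le
    · rw [← ENNReal.coe_le_coe, FiniteMeasure.ennreal_coeFn_eq_coeFn_toMeasure]
      exact htail γ hγ hγC n
    · have hf : Measurable fun x => (f x : ℝ≥0∞) := f.continuous.measurable.coe_nnreal_ennreal
      refine congrArg ENNReal.toNNReal ?_
      change ∫⁻ z, (b₁ f z : ℝ≥0∞) ∂(R γ) = _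
      rw [hRint γ _ (b₁ f).continuous.measurable.coe_nnreal_ennreal,
        ← lintegral_fst_of_mem_Adm hm hγ (f := fun x => (weight A p x : ℝ≥0∞) * f x) (hhm.mul hf)
          fun x hx => by rw [hh0 x hx, zero_mul]]
      exact lintegral_congr fun z => by rw [hb₁', hwc]
    · have hf : Measurable fun x => (f x : ℝ≥0∞) := f.continuous.measurable.coe_nnreal_ennreal
      refine congrArg ENNReal.toNNReal ?_
      change ∫⁻ z, (b₂ f z : ℝ≥0∞) ∂(R γ) = _
      rw [hRint γ _ (b₂ f).continuous.measurable.coe_nnreal_ennreal,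
        ← lintegral_snd_of_mem_Adm hm hγ (f := fun x => (weight A p x : ℝ≥0∞) * f x) (hhm.mul hf)
          fun x hx => by rw [hh0 x hx, zero_mul]]
      exact lintegral_congr fun z => by rw [hb₂', hwc]
  obtain ⟨ρ, ⟨hρS, hρT⟩, hρ⟩ := LowerSemicontinuousOn.exists_isMinOn ⟨_, hmem γ₀ hγ₀ le_rfl⟩
    (hS.inter_right hT) ((lowerSemicontinuous_lintegral hc).lowerSemicontinuousOn (S ∩ T))
  -- The minimiser, with the weight removed.
  let γ : Measure (EOmega A) :=
    (ρ : Measure (EOmega A)).withDensity fun z => (weightE p z : ℝ≥0∞)⁻¹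
  have hγint : ∀ F : EOmega A → ℝ≥0∞, Measurable F →
      ∫⁻ z, F z ∂γ = ∫⁻ z, (weightE p z : ℝ≥0∞)⁻¹ * F z ∂(ρ : Measure (EOmega A)) := fun F hF =>
    lintegral_withDensity_eq_lintegral_mul _ hwm.inv hF
  have hγcost : cost p γ = ∫⁻ z, c z ∂(ρ : Measure (EOmega A)) := by
    rw [cost, hγint _ measurable_cost]
    exact lintegral_congr fun z => (hcw z).symm
  have hγ : γ ∈ Adm μ ν := by
    have hμ' := lintegral_weight_lt_top hA' hp hμ
    have hν' := lintegral_weight_lt_top hA' hp hν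
    refine ⟨marg_withDensity_eq hA hA' hp hμ' measurable_fst_eOmega fun f => ?_,
      marg_withDensity_eq hA hA' hp hν' measurable_snd_eOmega fun f => ?_⟩
    · simp only [← hb₁']
      rw [← FiniteMeasure.testAgainstNN_coe_eq, (hρT f).1, ENNReal.coe_toNNReal (hfin' μ hμ' f)]
    · simp only [← hb₂']
      rw [← FiniteMeasure.testAgainstNN_coe_eq, (hρT f).2, ENNReal.coe_toNNReal (hfin' ν hν' f)]
  have hle : ∀ γ' ∈ Adm μ ν, cost p γ' ≤ C → cost p γ ≤ cost p γ' := by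
    intro γ' hγ' hC
    rw [hγcost, ← hRcost γ']
    exact hρ (hmem γ' hγ' hC)
  have hγC := hle γ₀ hγ₀ le_rfl
  refine ⟨γ, (mem_Opt_iff hp).2 ⟨hγ, fun γ' hγ' => ?_⟩, hγC.trans_lt hfin⟩
  rcases le_total (cost p γ') C with h | h
  · exact hle γ' hγ' h
  · exact hγC.trans h

end Existence

/-! ### Geodesics of measures -/

section MeasureGeodesics

variable {X : Type*} [MetricSpace X] [ProperSpace X] [MeasurableSpace X] [BorelSpace X] {A : Set X}
variable {p : ℝ}

theorem Wb_ne_top (hA : IsClosed A) (hA' : A.Nonempty) (hp : 0 < p) (μ ν : Mp A p) :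
    Wb p μ.1 ν.1 ≠ ∞ := by
  obtain ⟨γ, hγ, hc⟩ := exists_mem_Adm_cost_lt_top hA hA' μ.2.2 ν.2.2
  exact ((Wb_le_of_mem_Adm hγ).trans_lt (ENNReal.rpow_lt_top_of_nonneg (by positivity) hc.ne)).ne

theorem Wb_eq_ofReal_dist (hA : IsClosed A) (hA' : A.Nonempty) (hp : 0 < p) (μ ν : Mp A p) :
    Wb p μ.1 ν.1 = ENNReal.ofReal (dist μ ν) :=
  (ENNReal.ofReal_toReal (Wb_ne_top hA hA' hp μ ν)).symm

theorem Wb_self (hA : MeasurableSet A) (hp : 0 < p) (μ : Measure (Omega A)) : Wb p μ μ = 0 := by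
  have := Wb_marg_le (p := p) hA hp μ measurable_subtype_coe measurable_subtype_coe
  rw [marg_val hA] at this
  simpa [hp] using this

/-- The distance `Wb_p` satisfies the axioms of a pseudometric, which is all that the arguments on
geodesics require. -/
noncomputable abbrev Mp.pseudoMetricSpace (hA : IsClosed A) (hA' : A.Nonempty) (hp : 1 ≤ p) :
    PseudoMetricSpace (Mp A p) where
  dist := dist
  dist_self μ := by
    change (Wb p μ.1 μ.1).toReal = 0
    rw [Wb_self hA.measurableSet (by linarith), ENNReal.toReal_zero]
  dist_comm μ ν := congrArg ENNReal.toReal (Wb_comm μ.1 ν.1)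
  dist_triangle μ ν τ := by
    have hp0 : 0 < p := by linarith
    have : Nonempty X := hA'.to_type
    have : SigmaFinite ν.1 := sigmaFinite_of_isRadon hA ν.2.1
    change (Wb p μ.1 τ.1).toReal ≤ (Wb p μ.1 ν.1).toReal + (Wb p ν.1 τ.1).toReal
    rw [← ENNReal.toReal_add (Wb_ne_top hA hA' hp0 μ ν) (Wb_ne_top hA hA' hp0 ν τ)]
    exact ENNReal.toReal_mono (ENNReal.add_ne_top.2
      ⟨Wb_ne_top hA hA' hp0 μ ν, Wb_ne_top hA hA' hp0 ν τ⟩)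
      (Wb_triangle hA.measurableSet hp μ.1 ν.1 τ.1)

theorem cost_rpow_of_mem_Opt (hp : 0 < p) {μ ν : Measure (Omega A)} {γ : Measure (EOmega A)}
    (h : γ ∈ Opt p μ ν) : cost p γ ^ (1 / p) = Wb p μ ν := by
  rw [h.2, one_div, ENNReal.rpow_rpow_inv hp.ne']

/-- Moving the mass of an optimal plan along geodesics of `X`, chosen measurably, yields geodesics
of measures. -/
theorem isGeodesicSpace_Mp (hA : IsClosed A) (hA' : A.Nonempty) (hX : IsGeodesicSpace X)
    (hp : 1 ≤ p) : IsGeodesicSpace (Mp A p) := by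
  intro μ ν
  have hp0 : 0 < p := by linarith
  have hm := hA.measurableSet
  obtain ⟨γ, hγ, hγfin⟩ := exists_mem_Opt hA hA' hp0 μ.2.2 ν.2.2
  obtain ⟨G, hG, hGg⟩ := exists_measurable_geodesics hX
  have hG' : ∀ t, Measurable fun z : EOmega A => G z.1 t := fun t =>
    (hG t).comp measurable_subtype_coe
  have hGd : ∀ (z : X × X) (s t : I), s ≤ t →
      edist (G z s) (G z t) = ENNReal.ofReal ((t : ℝ) - s) * edist z.1 z.2 := by
    intro z s t hst
    have hst' : (0 : ℝ) ≤ t - s := sub_nonneg.2 hst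
    obtain ⟨h1, h2, h3⟩ := hGg z
    rw [edist_dist, edist_dist, h1 s t, h2, h3, abs_sub_comm, abs_of_nonneg hst', mul_comm,
      ENNReal.ofReal_mul hst']
  have hfin : ∀ t, ∫⁻ x, Metric.infEDist (x : X) A ^ p ∂marg A γ (fun z => G z.1 t) < ∞ := by
    intro t
    have hi : Measurable fun x : X => Metric.infEDist x A ^ p :=
      Metric.continuous_infEDist.measurable.pow_const p
    have hi0 : ∀ x ∈ A, Metric.infEDist x A ^ p = 0 := fun x hx => by
      rw [Metric.infEDist_zero_of_mem hx, ENNReal.zero_rpow_of_pos hp0]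
    rw [lintegral_marg_of_eq_zero hm γ (hG' t) hi hi0]
    have hle : ∀ z : EOmega A, Metric.infEDist (G z.1 t) A ^ p ≤
        2 ^ (p - 1) * (Metric.infEDist z.1.1 A ^ p + edist z.1.1 z.1.2 ^ p) := by
      intro z
      refine le_trans (ENNReal.rpow_le_rpow ?_ hp0.le)
        (ENNReal.rpow_add_le_mul_rpow_add_rpow _ _ hp)
      refine Metric.infEDist_le_infEDist_add_edist.trans (add_le_add_right ?_ _)
      have h := hGd z.1 0 t t.2.1
      rw [(hGg z.1).2.1] at h
      rw [edist_comm, h]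
      refine mul_le_of_le_one_left zero_le ?_
      rw [ENNReal.ofReal_le_one]
      simpa using t.2.2
    refine (lintegral_mono hle).trans_lt ?_
    rw [lintegral_const_mul _
        (f := fun z : EOmega A => Metric.infEDist z.1.1 A ^ p + edist z.1.1 z.1.2 ^ p)
        ((hi.comp measurable_fst_eOmega).add measurable_cost),
      lintegral_add_right _ measurable_cost, lintegral_fst_of_mem_Adm hm hγ.1 hi hi0]
    exact ENNReal.mul_lt_top (ENNReal.rpow_lt_top_of_nonneg (by linarith) (by simp))
      (ENNReal.add_lt_top.2 ⟨μ.2.2, hγfin⟩)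
  let ξ : I → Mp A p := fun t =>
    ⟨marg A γ fun z => G z.1 t, isRadon_of_lintegral_lt_top hA hp0 (hfin t), hfin t⟩
  have h0 : ξ 0 = μ := Subtype.ext <| by
    have : (fun z : EOmega A => G z.1 0) = fun z => z.1.1 := funext fun z => (hGg z.1).2.1
    change marg A γ (fun z => G z.1 0) = μ.1
    rw [this]
    exact hγ.1.1
  have h1 : ξ 1 = ν := Subtype.ext <| by
    have : (fun z : EOmega A => G z.1 1) = fun z => z.1.2 := funext fun z => (hGg z.1).2.2
    change marg A γ (fun z => G z.1 1) = ν.1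
    rw [this]
    exact hγ.1.2
  let _ := Mp.pseudoMetricSpace hA hA' hp
  refine ⟨⟨ξ, isGeodesic_of_dist_le fun s t hst => ?_⟩, h0, h1⟩
  have hst' : (0 : ℝ) ≤ t - s := sub_nonneg.2 hst
  rw [h0, h1]
  change (Wb p (ξ s).1 (ξ t).1).toReal ≤ (Wb p μ.1 ν.1).toReal * ((t : ℝ) - s)
  have hW : Wb p (ξ s).1 (ξ t).1 ≤ ENNReal.ofReal ((t : ℝ) - s) * Wb p μ.1 ν.1 := by
    refine (Wb_marg_le hm hp0 γ (hG' s) (hG' t)).trans_eq ?_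
    simp only [fun z => hGd z s t hst, ENNReal.mul_rpow_of_nonneg _ _ hp0.le]
    rw [lintegral_const_mul _ measurable_cost,
      ENNReal.mul_rpow_of_nonneg _ _ (by positivity : 0 ≤ 1 / p), one_div,
      ENNReal.rpow_rpow_inv hp0.ne', ← one_div]
    congr 1
    exact cost_rpow_of_mem_Opt hp0 hγ
  refine (ENNReal.toReal_mono (ENNReal.mul_ne_top ENNReal.ofReal_ne_top
    (Wb_ne_top hA hA' hp0 μ ν)) hW).trans_eq ?_
  rw [ENNReal.toReal_mul, ENNReal.toReal_ofReal hst', mul_comm]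

end MeasureGeodesics

/-! ### Rigidity -/

section Convexity

variable {p l a b c : ℝ}

/-- Convexity of the power, applied to `a + b = l (a / l) + (1 - l) (b / (1 - l))`. -/
theorem rpow_le_of_le_add (hp : 1 < p) (hl0 : 0 < l) (hl1 : l < 1) (ha : 0 ≤ a) (hb : 0 ≤ b)
    (hc : 0 ≤ c) (h : c ≤ a + b) : c ^ p ≤ l * (a / l) ^ p + (1 - l) * (b / (1 - l)) ^ p := by
  have hl : 0 < 1 - l := by linarith
  have h1 := (strictConvexOn_rpow hp).convexOn.2 (Set.mem_Ici.2 (div_nonneg ha hl0.le))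
    (Set.mem_Ici.2 (div_nonneg hb hl.le)) hl0.le hl.le (by ring)
  simp only [smul_eq_mul] at h1
  rw [mul_div_cancel₀ a hl0.ne', mul_div_cancel₀ b hl.ne'] at h1
  exact (Real.rpow_le_rpow hc h (by linarith)).trans h1

/-- The case of equality in `rpow_le_of_le_add`, where strict convexity enters. -/
theorem eq_mul_of_le_rpow (hp : 1 < p) (hl0 : 0 < l) (hl1 : l < 1) (ha : 0 ≤ a) (hb : 0 ≤ b)
    (hc : 0 ≤ c) (h : c ≤ a + b)
    (heq : l * (a / l) ^ p + (1 - l) * (b / (1 - l)) ^ p ≤ c ^ p) :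
    a = l * c ∧ b = (1 - l) * c := by
  have hl : 0 < 1 - l := by linarith
  have hcp : c ^ p ≤ (a + b) ^ p := Real.rpow_le_rpow hc h (by linarith)
  have hne : a / l = b / (1 - l) := by
    by_contra hne
    have h1 := (strictConvexOn_rpow hp).2 (Set.mem_Ici.2 (div_nonneg ha hl0.le))
      (Set.mem_Ici.2 (div_nonneg hb hl.le)) hne hl0 hl (by ring)
    simp only [smul_eq_mul] at h1
    rw [mul_div_cancel₀ a hl0.ne', mul_div_cancel₀ b hl.ne'] at h1
    linarith
  have hsum : a / l = a + b := by
    rw [div_eq_div_iff hl0.ne' hl.ne'] at hne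
    rw [div_eq_iff hl0.ne']
    linarith
  have hcab : c = a + b := by
    refine le_antisymm h ?_
    rw [← hne, hsum] at heq
    have : (a + b) ^ p ≤ c ^ p := by linarith
    exact (Real.rpow_le_rpow_iff (by linarith) hc (by linarith)).1 this
  rw [div_eq_iff hl0.ne'] at hsum
  constructor <;> rw [hcab] <;> linarith

end Convexity

section DiracKernels

open ProbabilityTheory

/-- Where the values of a kernel are Dirac measures, their atoms are given by a measurable map. -/
theorem exists_measurable_of_dirac {α β : Type*} [MeasurableSpace α] [MeasurableSpace β]
    [StandardBorelSpace β] [Nonempty β] (κ : Kernel α β) :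
    ∃ T : α → β, Measurable T ∧ ∀ y x, κ y = Measure.dirac x → T y = x := by
  -- In a Borel embedding into `ℝ`, the atom of a Dirac measure is its barycentre.
  have he := measurableEmbedding_embeddingReal β
  obtain ⟨g, hg, hge⟩ := he.exists_measurable_extend measurable_id fun _ => inferInstance
  refine ⟨fun y => g (∫ x, embeddingReal β x ∂κ y),
    hg.comp (he.measurable.stronglyMeasurable.integral_kernel).measurable, fun y x hx => ?_⟩
  change g (∫ x, embeddingReal β x ∂κ y) = x
  rw [hx, integral_dirac]
  exact congrFun hge x

theorem eq_dirac_of_ae_eq {β : Type*} [MeasurableSpace β] {μ : Measure β} [IsProbabilityMeasure μ]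
    {x : β} (h : ∀ᵐ z ∂μ, z = x) : μ = Measure.dirac x := by
  have h1 : μ.map id = μ.map fun _ => x := Measure.map_congr h
  rwa [Measure.map_id, Measure.map_const, measure_univ, one_smul] at h1

end DiracKernels

section Rigidity

open ProbabilityTheory

variable {X : Type*} [MetricSpace X] [ProperSpace X] [MeasurableSpace X] [BorelSpace X] {A : Set X}
variable {p l : ℝ}

/-- The point `y` divides a geodesic from `x` to `z` in the ratio `l : 1 - l`. -/
def Aligned (l : ℝ) (t : X × X × X) : Prop :=
  dist t.1 t.2.1 = l * dist t.1 t.2.2 ∧ dist t.2.1 t.2.2 = (1 - l) * dist t.1 t.2.2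

/-- When three measures lie on a geodesic, the gluing of optimal plans out of the middle one is
carried by aligned triples. With `q(s) = s ^ p`, its cost lies between `D ^ p` and the integral of
`l q(d(x, y) / l) + (1 - l) q(d(y, z) / (1 - l)) ≥ q(d(x, z))`, which is `D ^ p` as well, so that
the two integrands agree almost everywhere. -/
theorem ae_aligned_glue (hA : MeasurableSet A) (hp : 1 < p) (hl0 : 0 < l) (hl1 : l < 1)
    {μ₀ μ₁ μ₂ : Measure (Omega A)} [SFinite μ₁] {D : ℝ≥0∞} (hD : D ≠ ∞) (h02 : D ≤ Wb p μ₀ μ₂)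
    (h10 : Wb p μ₁ μ₀ = ENNReal.ofReal l * D) (h12 : Wb p μ₁ μ₂ = ENNReal.ofReal (1 - l) * D)
    {γ γ' : Measure (EOmega A)} (hγ : γ ∈ Opt p μ₁ μ₀) (hγ' : γ' ∈ Opt p μ₁ μ₂)
    {κ η : Kernel (Omega A) X} [IsMarkovKernel κ] [IsMarkovKernel η]
    (hκ : γ = (μ₁ ⊗ₘ κ).map ofSource + γ.restrict {z | z.1.1 ∈ A})
    (hη : γ' = (μ₁ ⊗ₘ η).map ofSource + γ'.restrict {z | z.1.1 ∈ A}) :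
    ∀ᵐ t ∂glue μ₁ κ η γ γ', Aligned l t := by
  have hp0 : 0 < p := by linarith
  have hl : 0 < 1 - l := by linarith
  let a : ℝ≥0∞ := ENNReal.ofReal (l * l⁻¹ ^ p)
  let b : ℝ≥0∞ := ENNReal.ofReal ((1 - l) * (1 - l)⁻¹ ^ p)
  let f : X × X × X → ℝ≥0∞ := fun t => edist t.1 t.2.2 ^ p
  let g : X × X × X → ℝ≥0∞ := fun t => a * edist t.2.1 t.1 ^ p + b * edist t.2.1 t.2.2 ^ p
  have hf : ∀ t, f t = ENNReal.ofReal (dist t.1 t.2.2 ^ p) := fun t => by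
    simp only [f, edist_dist, ENNReal.ofReal_rpow_of_nonneg dist_nonneg hp0.le]
  have hg : ∀ t, g t = ENNReal.ofReal (l * (dist t.1 t.2.1 / l) ^ p +
      (1 - l) * (dist t.2.1 t.2.2 / (1 - l)) ^ p) := fun t => by
    simp only [g, a, b, edist_dist, ENNReal.ofReal_rpow_of_nonneg dist_nonneg hp0.le]
    rw [← ENNReal.ofReal_mul (by positivity), ← ENNReal.ofReal_mul (by positivity),
      ← ENNReal.ofReal_add (by positivity) (by positivity), dist_comm t.2.1 t.1, div_eq_mul_inv,
      div_eq_mul_inv, Real.mul_rpow dist_nonneg (by positivity),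
      Real.mul_rpow dist_nonneg (by positivity)]
    congr 1
    ring
  have hfg : ∀ t, f t ≤ g t := fun t => by
    rw [hf, hg]
    exact ENNReal.ofReal_le_ofReal (rpow_le_of_le_add hp hl0 hl1 dist_nonneg dist_nonneg
      dist_nonneg (dist_triangle _ _ _))
  have hm : Measurable fun z : X × X => edist z.1 z.2 ^ p := measurable_edist.pow_const p
  have hz : ∀ x ∈ A, edist x x ^ p = 0 := fun x _ => by simp [hp0]
  have m1 : Measurable fun t : X × X × X => edist t.2.1 t.1 ^ p :=
    ((measurable_fst.comp measurable_snd).edist measurable_fst).pow_const p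
  have m2 : Measurable fun t : X × X × X => edist t.2.1 t.2.2 ^ p :=
    ((measurable_fst.comp measurable_snd).edist (measurable_snd.comp measurable_snd)).pow_const p
  have hab : ∀ r : ℝ, 0 < r → ENNReal.ofReal (r * r⁻¹ ^ p) * (ENNReal.ofReal r * D) ^ p =
      ENNReal.ofReal r * D ^ p := fun r hr => by
    rw [ENNReal.mul_rpow_of_nonneg _ _ hp0.le, ENNReal.ofReal_rpow_of_nonneg hr.le hp0.le,
      ← mul_assoc, ← ENNReal.ofReal_mul (by positivity), mul_assoc, ← Real.mul_rpow (by positivity)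
        hr.le, inv_mul_cancel₀ hr.ne', Real.one_rpow, mul_one]
  have hDp : D ^ p ≠ ∞ := ENNReal.rpow_ne_top_of_nonneg hp0.le hD
  have hgint : ∫⁻ t, g t ∂glue μ₁ κ η γ γ' = D ^ p := by
    have c1 : ∫⁻ t, edist t.2.1 t.1 ^ p ∂glue μ₁ κ η γ γ' = cost p γ :=
      lintegral_glue_left hA hκ hm hz
    have c2 : ∫⁻ t, edist t.2.1 t.2.2 ^ p ∂glue μ₁ κ η γ γ' = cost p γ' :=
      lintegral_glue_right hA hη hm hz
    rw [lintegral_add_left (m1.const_mul a), lintegral_const_mul a m1, lintegral_const_mul b m2,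
      c1, c2, hγ.2, hγ'.2, h10, h12, hab l hl0, hab (1 - l) hl, ← add_mul,
      ← ENNReal.ofReal_add hl0.le hl.le, add_sub_cancel, ENNReal.ofReal_one, one_mul]
  have hfint : D ^ p ≤ ∫⁻ t, f t ∂glue μ₁ κ η γ γ' := by
    have e0 : marg A (glue μ₁ κ η γ γ') (fun t => t.1) = μ₀ :=
      (marg_glue_left hA hκ).trans hγ.1.2
    have e2 : marg A (glue μ₁ κ η γ γ') (fun t => t.2.2) = μ₂ :=
      (marg_glue_right hA hη).trans hγ'.1.2
    refine (ENNReal.rpow_le_rpow h02 hp0.le).trans ?_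
    rw [← e0, ← e2]
    exact Wb_pow_marg_le hA hp0 _ measurable_fst (measurable_snd.comp measurable_snd)
  have hffin : ∫⁻ t, f t ∂glue μ₁ κ η γ γ' ≠ ∞ :=
    ((lintegral_mono hfg).trans_lt (hgint.trans_lt hDp.lt_top)).ne
  have hae := ae_eq_of_ae_le_of_lintegral_le (ae_of_all _ hfg) hffin
    ((m1.const_mul a).add (m2.const_mul b)).aemeasurable (hgint.trans_le hfint)
  filter_upwards [hae] with t ht
  refine eq_mul_of_le_rpow hp hl0 hl1 dist_nonneg dist_nonneg dist_nonneg (dist_triangle _ _ _) ?_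
  rw [hf, hg] at ht
  exact (ENNReal.ofReal_le_ofReal_iff (by positivity)).1 ht.ge

/-- On a geodesic of measures, no mass of an optimal plan leaves `A` after an intermediate time. -/
theorem restrict_eq_zero_of_ae_aligned (hA : MeasurableSet A) (hl0 : 0 < l)
    {μ₁ : Measure (Omega A)} {γ γ' : Measure (EOmega A)} {κ η : Kernel (Omega A) X}
    (h : ∀ᵐ t ∂glue μ₁ κ η γ γ', Aligned l t) : γ'.restrict {z | z.1.1 ∈ A} = 0 := by
  rw [glue, ae_add_measure_iff, ae_add_measure_iff] at h
  have h3 := ae_of_ae_map measurable_glue_thd.aemeasurable h.2.2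
  have h4 : ∀ᵐ z ∂γ'.restrict {z | z.1.1 ∈ A}, False := by
    filter_upwards [h3, ae_restrict_mem (measurableSet_source hA)] with z hz hzA
    have h5 : dist z.1.1 z.1.2 = 0 := by
      have := hz.1
      simp only [dist_self] at this
      exact (mul_eq_zero.1 this.symm).resolve_left hl0.ne'
    exact z.2 ⟨hzA, (dist_eq_zero.1 h5) ▸ hzA⟩
  exact ae_eq_bot.1 (Filter.eventually_false_iff_eq_bot.1 h4)

theorem ae_aligned_kernel {μ₁ : Measure (Omega A)} [SFinite μ₁] {γ γ' : Measure (EOmega A)}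
    {κ η : Kernel (Omega A) X} [IsMarkovKernel κ] [IsMarkovKernel η]
    (h : ∀ᵐ t ∂glue μ₁ κ η γ γ', Aligned l t) :
    ∀ᵐ y ∂μ₁, ∀ᵐ x ∂κ y, ∀ᵐ z ∂η y, Aligned l (x, y.1, z) := by
  rw [glue, ae_add_measure_iff] at h
  have h1 := Measure.ae_ae_of_ae_compProd (ae_of_ae_map measurable_glue_fst.aemeasurable h.1)
  filter_upwards [h1] with y hy
  rw [Kernel.prod_apply] at hy
  exact Measure.ae_ae_of_ae_prod hy

/-- The continuation of a geodesic of measures beyond an intermediate time is unique, and the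
optimal plan out of the intermediate measure is unique and induced by a map. Almost every point of
the intermediate measure is a common intermediate point of geodesics of `X` with the same start, so
that the non-branching property leaves only one end point. -/
theorem exists_map_of_aligned (hA : IsClosed A) (hA' : A.Nonempty) (hX : IsNonBranching X)
    (hp : 1 < p) (hl0 : 0 < l) (hl1 : l < 1) {μ₀ μ₁ μ₂ μ₂' : Mp A p} {D : ℝ}
    (h10 : dist μ₁ μ₀ = l * D) (h02 : dist μ₀ μ₂ = D) (h12 : dist μ₁ μ₂ = (1 - l) * D)
    (h02' : dist μ₀ μ₂' = D) (h12' : dist μ₁ μ₂' = (1 - l) * D)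
    {γ γ' : Measure (EOmega A)} (hγ : γ ∈ Opt p μ₁.1 μ₂.1) (hγ' : γ' ∈ Opt p μ₁.1 μ₂'.1) :
    γ = γ' ∧ ∃ T : Omega A → X, Measurable T ∧ γ = μ₁.1.map fun y => ofSource (y, T y) := by
  have hp0 : 0 < p := by linarith
  have hl : 0 < 1 - l := by linarith
  have hm := hA.measurableSet
  have : Nonempty X := hA'.to_type
  have : SigmaFinite μ₁.1 := sigmaFinite_of_isRadon hA μ₁.2.1
  obtain ⟨γ₀, hγ₀, -⟩ := exists_mem_Opt hA hA' hp0 μ₁.2.2 μ₀.2.2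
  obtain ⟨κ, _, hκ⟩ := exists_kernel_of_mem_Adm hm hγ₀.1
  obtain ⟨η, _, hη⟩ := exists_kernel_of_mem_Adm hm hγ.1
  obtain ⟨η', _, hη'⟩ := exists_kernel_of_mem_Adm hm hγ'.1
  have hW : ∀ {μ ν : Mp A p} {r : ℝ}, 0 ≤ r → dist μ ν = r * D →
      Wb p μ.1 ν.1 = ENNReal.ofReal r * ENNReal.ofReal D := fun hr h => by
    rw [Wb_eq_ofReal_dist hA hA' hp0, h, ENNReal.ofReal_mul hr]
  have hal := ae_aligned_glue hm hp hl0 hl1 ENNReal.ofReal_ne_top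
    (by rw [Wb_eq_ofReal_dist hA hA' hp0, h02]) (hW hl0.le h10) (hW hl.le h12) hγ₀ hγ hκ hη
  have hal' := ae_aligned_glue hm hp hl0 hl1 ENNReal.ofReal_ne_top
    (by rw [Wb_eq_ofReal_dist hA hA' hp0, h02']) (hW hl0.le h10) (hW hl.le h12') hγ₀ hγ' hκ hη'
  rw [restrict_eq_zero_of_ae_aligned hm hl0 hal, add_zero] at hη
  rw [restrict_eq_zero_of_ae_aligned hm hl0 hal', add_zero] at hη'
  obtain ⟨T, hT, hTη⟩ := exists_measurable_of_dirac η
  have hdirac : ∀ᵐ y ∂μ₁.1, η y = Measure.dirac (T y) ∧ η' y = Measure.dirac (T y) := by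
    filter_upwards [ae_aligned_kernel hal, ae_aligned_kernel hal'] with y h1 h2
    obtain ⟨x, hx, hx'⟩ := (h1.and h2).exists
    have huniq : ∀ z z', Aligned l (x, y.1, z) → Aligned l (x, y.1, z') → z = z' :=
      fun z z' hz hz' => hX.eq_of_aligned hl0 hl1 hz.1 hz.2 hz'.1 hz'.2
    obtain ⟨z, hz⟩ := hx.exists
    have e1 : η y = Measure.dirac z :=
      eq_dirac_of_ae_eq (hx.mono fun w hw => huniq w z hw hz)
    have e2 : η' y = Measure.dirac z :=
      eq_dirac_of_ae_eq (hx'.mono fun w hw => huniq w z hw hz)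
    rw [hTη y z e1]
    exact ⟨e1, e2⟩
  have key : ∀ (τ : Kernel (Omega A) X) [IsMarkovKernel τ],
      (∀ᵐ y ∂μ₁.1, τ y = Measure.dirac (T y)) →
      (μ₁.1 ⊗ₘ τ).map ofSource = μ₁.1.map fun y => ofSource (y, T y) := by
    intro τ _ hτ
    have : τ =ᵐ[μ₁.1] Kernel.deterministic T hT := by
      filter_upwards [hτ] with y hy
      rw [hy, Kernel.deterministic_apply]
    rw [Measure.compProd_congr this, Measure.compProd_deterministic hT]
    exact Measure.map_map measurable_ofSource (measurable_id.prodMk hT)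
  have k1 := key η (hdirac.mono fun y hy => hy.1)
  have k2 := key η' (hdirac.mono fun y hy => hy.2)
  rw [← hη] at k1
  rw [← hη'] at k2
  exact ⟨k1.trans k2.symm, T, hT, k1⟩

theorem eq_of_aligned (hA : IsClosed A) (hA' : A.Nonempty) (hX : IsNonBranching X)
    (hp : 1 < p) (hl0 : 0 < l) (hl1 : l < 1) {μ₀ μ₁ μ₂ μ₂' : Mp A p} {D : ℝ}
    (h10 : dist μ₁ μ₀ = l * D) (h02 : dist μ₀ μ₂ = D) (h12 : dist μ₁ μ₂ = (1 - l) * D)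
    (h02' : dist μ₀ μ₂' = D) (h12' : dist μ₁ μ₂' = (1 - l) * D) : μ₂ = μ₂' := by
  have hp0 : 0 < p := by linarith
  obtain ⟨γ, hγ, -⟩ := exists_mem_Opt hA hA' hp0 μ₁.2.2 μ₂.2.2
  obtain ⟨γ', hγ', -⟩ := exists_mem_Opt hA hA' hp0 μ₁.2.2 μ₂'.2.2
  have h := (exists_map_of_aligned hA hA' hX hp hl0 hl1 h10 h02 h12 h02' h12' hγ hγ').1
  exact Subtype.ext (by rw [← hγ.1.2, ← hγ'.1.2, h])

/-- Two geodesics of measures that agree at the times `0` and `t` agree after `t`, since they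
continue the same geodesic. In particular they agree at time `1`, and then also before `t`, by the
same argument with time reversed. -/
theorem injective_Geo_Mp (hA : IsClosed A) (hA' : A.Nonempty) (hX : IsNonBranching X)
    (hp : 1 < p) {t : I} (ht0 : 0 < t) (ht1 : t < 1) :
    Function.Injective fun ξ : Geo (Mp A p) => (ξ.1 0, ξ.1 t) := by
  rintro ⟨ξ, hξ⟩ ⟨ζ, hζ⟩ h
  have hI0 : ((0 : I) : ℝ) = 0 := rfl
  have hI1 : ((1 : I) : ℝ) = 1 := rfl
  have e0 : ξ 0 = ζ 0 := congrArg Prod.fst h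
  have et : ξ t = ζ t := congrArg Prod.snd h
  have ht0' : (0 : ℝ) < t := ht0
  have ht1' : (t : ℝ) < 1 := ht1
  have hD : dist (ξ 0) (ξ 1) = dist (ζ 0) (ζ 1) := by
    have h1 := hξ 0 t
    have h2 := hζ 0 t
    rw [et, e0, h2, ← e0] at h1
    rw [← e0]
    refine (mul_right_cancel₀ ?_ h1).symm
    simp [ht0'.ne']
  have hξ' : ∀ s t : I, s ≤ t → dist (ξ s) (ξ t) = dist (ξ 0) (ξ 1) * ((t : ℝ) - s) ∧
      dist (ξ t) (ξ s) = dist (ξ 0) (ξ 1) * ((t : ℝ) - s) := fun s t hst => by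
    have hst' : (0 : ℝ) ≤ t - s := sub_nonneg.2 hst
    rw [hξ s t, hξ t s, abs_sub_comm (s : ℝ), abs_of_nonneg hst']
    exact ⟨rfl, rfl⟩
  have hζ' : ∀ s t : I, s ≤ t → dist (ζ s) (ζ t) = dist (ξ 0) (ξ 1) * ((t : ℝ) - s) ∧
      dist (ζ t) (ζ s) = dist (ξ 0) (ξ 1) * ((t : ℝ) - s) := fun s t hst => by
    have hst' : (0 : ℝ) ≤ t - s := sub_nonneg.2 hst
    rw [hζ s t, hζ t s, abs_sub_comm (s : ℝ), abs_of_nonneg hst', hD]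
    exact ⟨rfl, rfl⟩
  have hafter : ∀ s : I, t < s → ξ s = ζ s := by
    intro s hts
    have hts' : (t : ℝ) < s := hts
    have hs0 : (0 : ℝ) < s := ht0'.trans hts'
    have z02 := (hζ' 0 s s.2.1).1
    have z12 := (hζ' t s hts.le).1
    rw [← e0] at z02
    rw [← et] at z12
    refine eq_of_aligned hA hA' hX hp (div_pos ht0' hs0) ((div_lt_one hs0).2 hts')
      (μ₀ := ξ 0) (μ₁ := ξ t) (D := dist (ξ 0) (ξ 1) * s) ?_ ?_ ?_ ?_ ?_
    · rw [(hξ' 0 t ht0.le).2, hI0]; field_simp; ring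
    · rw [(hξ' 0 s s.2.1).1, hI0, sub_zero]
    · rw [(hξ' t s hts.le).1]; field_simp
    · rw [z02, hI0, sub_zero]
    · rw [z12]; field_simp
  have e1 : ξ 1 = ζ 1 := hafter 1 ht1
  have hbefore : ∀ s : I, s < t → ξ s = ζ s := by
    intro s hts
    have hts' : (s : ℝ) < t := hts
    have hs1 : (0 : ℝ) < 1 - s := by linarith
    have z02 := (hζ' s 1 s.2.2).2
    have z12 := (hζ' s t hts.le).2
    rw [← e1] at z02
    rw [← et] at z12
    refine eq_of_aligned hA hA' hX hp (l := (1 - t) / (1 - s)) (div_pos (by linarith) hs1)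
      ((div_lt_one hs1).2 (by linarith)) (μ₀ := ξ 1) (μ₁ := ξ t)
      (D := dist (ξ 0) (ξ 1) * (1 - s)) ?_ ?_ ?_ ?_ ?_
    · rw [(hξ' t 1 ht1.le).1, hI1]; field_simp
    · rw [(hξ' s 1 s.2.2).2, hI1]
    · rw [(hξ' s t hts.le).2]; field_simp; ring
    · rw [z02, hI1]
    · rw [z12]; field_simp; ring
  refine Subtype.ext (funext fun s => ?_)
  rcases lt_trichotomy s t with hst | rfl | hst
  · exact hbefore s hst
  · exact et
  · exact hafter s hst

end Rigidity

end MetricPair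

theorem mainTheorem3 {X : Type*} [MetricSpace X] [ProperSpace X]
    [MeasurableSpace X] [BorelSpace X]
    (A : Set X) (hA : IsClosed A) (hA' : A.Nonempty)
    (hX : MetricPair.IsNonBranching X) (p : ℝ) (hp : 1 < p) :
    MetricPair.IsNonBranching (MetricPair.Mp A p) ∧
    ∀ μ : MetricPair.Geo (MetricPair.Mp A p), ∀ t : unitInterval, 0 < t → t < 1 →
      (∀ γ ∈ MetricPair.Opt p (μ.1 0).1 (μ.1 t).1, ∀ γ' ∈ MetricPair.Opt p (μ.1 0).1 (μ.1 t).1,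
        MetricPair.targetPart γ = MetricPair.targetPart γ') ∧
      ∀ γ ∈ MetricPair.Opt p (μ.1 0).1 (μ.1 t).1,
        ∃ T : MetricPair.Omega A → X, Measurable T ∧
          MetricPair.targetPart γ = (μ.1 t).1.map (MetricPair.graphMap T) := by
  refine ⟨⟨MetricPair.isGeodesicSpace_Mp hA hA' hX.1 hp.le, fun t ht0 ht1 =>
    MetricPair.injective_Geo_Mp hA hA' hX hp ht0 ht1⟩, fun μ t ht0 ht1 => ?_⟩
  obtain ⟨ξ, hξ⟩ := μ
  have ht0' : (0 : ℝ) < t := ht0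
  have ht1' : (t : ℝ) < 1 := ht1
  have hI0 : ((0 : unitInterval) : ℝ) = 0 := rfl
  have hI1 : ((1 : unitInterval) : ℝ) = 1 := rfl
  -- The uniqueness statement, for the geodesic run backwards from time `1` through `t` to `0`.
  have h1t : dist (ξ t) (ξ 1) = (1 - t) * dist (ξ 0) (ξ 1) := by
    rw [hξ t 1, hI1, abs_sub_comm, abs_of_pos (by linarith), mul_comm]
  have h10 : dist (ξ 1) (ξ 0) = dist (ξ 0) (ξ 1) := by
    rw [hξ 1 0, hI0, hI1]; simp
  have ht0d : dist (ξ t) (ξ 0) = (1 - (1 - t)) * dist (ξ 0) (ξ 1) := by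
    rw [hξ t 0, hI0, sub_zero, abs_of_pos ht0', mul_comm]; ring
  have key := fun {γ γ'} hγ hγ' => MetricPair.exists_map_of_aligned (γ := γ) (γ' := γ') hA hA' hX hp
    (l := 1 - t) (by linarith) (by linarith) h1t h10 ht0d h10 ht0d hγ hγ'
  refine ⟨fun γ hγ γ' hγ' => ?_, fun γ hγ => ?_⟩
  · have h := (key (MetricPair.map_swapE_mem_Opt hγ) (MetricPair.map_swapE_mem_Opt hγ')).1
    rw [← MetricPair.map_swapE_map_swapE γ, h, MetricPair.map_swapE_map_swapE]
  · obtain ⟨-, T, hT, h⟩ := key (MetricPair.map_swapE_mem_Opt hγ) (MetricPair.map_swapE_mem_Opt hγ)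
    refine ⟨T, hT, ?_⟩
    have hγT : γ = (ξ t).1.map (MetricPair.graphMap T) := by
      rw [← MetricPair.map_swapE_map_swapE γ, h]
      exact MeasureTheory.Measure.map_map MetricPair.measurable_swapE
        (MetricPair.measurable_ofSource.comp (measurable_id.prodMk hT))
    -- The plan is carried by `X × Ω`, as it comes out of a map with second component in `Ω`.
    rw [MetricPair.targetPart, MeasureTheory.Measure.restrict_eq_self_of_ae_mem]
    · exact hγT
    · have hgraph : Measurable (MetricPair.graphMap T) :=
        (hT.prodMk measurable_subtype_coe).subtype_mk
      rw [hγT]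
      exact (MeasureTheory.ae_map_iff hgraph.aemeasurable
        ((measurable_snd.comp measurable_subtype_coe) hA.measurableSet.compl)).2
        (MeasureTheory.ae_of_all _ fun y => y.2)
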